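/- Let $T=A_1\oplus A_1\oplus A_1(-1)\oplus A_1(-1)$, i.e. the lattice $\mathbb Z^4$ with the symmetric bilinear form of Gram matrix $\mathrm{diag}(2,2,-2,-2)$, let $\rho$ be the isometry of $T$ with matrix $J=A\oplus A$, $A=\begin{pmatrix}0&-1\\1&0\end{pmatrix}$, and extend the form bilinearly to $T\otimes\mathbb C=\mathbb C^4$. (For the generic $K3$ surface $X_\alpha$ obtained as minimal resolution of the fourfold cyclic cover of $\mathbb P^2$ branched along a plane quartic with five nodes, $T$ is the transcendental lattice and $\rho$ is the action on it of a generator of the group $G_\alpha\cong\mathbb Z/4$ of covering transformations.) Put $$D=\{z\in\mathbb P(T\otimes\mathbb C):\ \rho(z)=iz,\ (z,\bar z)>0\},\qquad \Gamma=\{\gamma\in O(T):\ \gamma\circ\rho=\rho\circ\gamma\},\qquad \mathcal M=D/\Gamma ;$$ $\mathcal M$ is the moduli space of pairs $(X_\alpha,G_\alpha)$. Let $\mathcal S$ be the upper half plane, let $H[2]\subset PSL(2,\mathbb Z)\subset PSL(2,\mathbb R)$ be the group of classes of matrices $\begin{pmatrix}a&b\\c&d\end{pmatrix}\in SL(2,\mathbb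 Z)$ with $c\equiv0\pmod 2$, let $F\in PSL(2,\mathbb R)$ be the class of $\begin{pmatrix}0&-1/\sqrt2\\\sqrt2&0\end{pmatrix}$, let $H[2]^+=H[2]\cup F\,H[2]$ (the Fricke modular group of level $2$, acting on $\mathcal S$ by Möbius transformations), and let $C(2)^+=\mathcal S/H[2]^+$ be the Fricke modular curve of level $2$. The quotients $\mathcal M$ and $C(2)^+$ carry the quotient topology and the quotient complex analytic structure: a function on an open subset of the quotient is holomorphic if and only if its pull-back to $D$, respectively $\mathcal S$, is holomorphic. Then there are isomorphisms of complex analytic spaces $$\mathcal M\;\cong\;C(2)^+\;\cong\;\mathbb A^1,$$ where $\mathbb A^1=\mathbb C$ is the complex affine line with its usual analytic structure. -/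

import Mathlib

open scoped LinearAlgebra.Projectivization MatrixGroups Manifold UpperHalfPlane

open TopologicalSpace

/-! ### Complex analytic structures given by a sheaf of complex-valued functions -/

/-- A sheaf of `ℂ`-algebras of complex-valued functions on a topological space `X`. The condition
`mem_iff_local` says that membership is a local property (restriction and gluing). -/
structure AnalyticStructure (X : Type*) [TopologicalSpace X] where
  /-- the algebra of functions on the open set `U` that are called holomorphic -/
  holo : (U : Opens X) → Subalgebra ℂ (U → ℂ)
  mem_iff_local : ∀ (U : Opens X) (f : U → ℂ), f ∈ holo U ↔
    ∀ x : U, ∃ (V : Opens X) (h : V ≤ U), x.1 ∈ V ∧ (fun y : V => f ⟨y.1, h y.2⟩) ∈ holo V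

/-- The two spaces are isomorphic as `ℂ`-ringed spaces: there is a homeomorphism `φ` such that, for
every open `U ⊆ Y`, a function on `U` is holomorphic if and only if its pull-back to `φ⁻¹(U)` is
holomorphic. -/
def AnalyticStructure.Isomorphic {X Y : Type*} [TopologicalSpace X] [TopologicalSpace Y]
    (A : AnalyticStructure X) (B : AnalyticStructure Y) : Prop :=
  ∃ φ : X ≃ₜ Y, ∀ (U : Opens Y) (f : U → ℂ),
    f ∈ B.holo U ↔
      (fun x : Opens.comap (φ : C(X, Y)) U => f ⟨φ x.1, x.2⟩) ∈
        A.holo (Opens.comap (φ : C(X, Y)) U)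

/-- The analytic structure of a one-dimensional complex manifold: the usual holomorphic functions
(a function on `U` is extended by zero in order to speak of differentiability at points of `U`). -/
noncomputable def AnalyticStructure.ofManifold (X : Type*) [TopologicalSpace X]
    [ChartedSpace ℂ X] : AnalyticStructure X where
  holo U :=
    { carrier := {f | ∀ x : U, MDifferentiableAt 𝓘(ℂ, ℂ) 𝓘(ℂ, ℂ)
        (Function.extend (Subtype.val : U → X) f 0) x.1}
      mul_mem' := by
        intro f g hf hg x
        refine ((hf x).mul (hg x)).congr_of_eventuallyEq ?_
        filter_upwards [U.isOpen.mem_nhds x.2] with y hy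
        have e : ∀ k : U → ℂ, Function.extend (Subtype.val : U → X) k 0 y = k ⟨y, hy⟩ :=
          fun k => Subtype.val_injective.extend_apply k 0 ⟨y, hy⟩
        simp [e]
      add_mem' := by
        intro f g hf hg x
        refine ((hf x).add (hg x)).congr_of_eventuallyEq ?_
        filter_upwards [U.isOpen.mem_nhds x.2] with y hy
        have e : ∀ k : U → ℂ, Function.extend (Subtype.val : U → X) k 0 y = k ⟨y, hy⟩ :=
          fun k => Subtype.val_injective.extend_apply k 0 ⟨y, hy⟩
        simp [e]
      algebraMap_mem' := by
        intro c x
        refine (mdifferentiableAt_const (c := c)).congr_of_eventuallyEq ?_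
        filter_upwards [U.isOpen.mem_nhds x.2] with y hy
        exact Subtype.val_injective.extend_apply (algebraMap ℂ (U → ℂ) c) 0 ⟨y, hy⟩ }
  mem_iff_local := by
    intro U f
    constructor
    · intro hf x
      exact ⟨U, le_rfl, x.2, hf⟩
    · intro hf x
      obtain ⟨V, h, hx, hV⟩ := hf x
      refine (hV ⟨x.1, hx⟩).congr_of_eventuallyEq ?_
      filter_upwards [V.isOpen.mem_nhds hx] with y hy
      rw [Subtype.val_injective.extend_apply f 0 ⟨y, h hy⟩]
      exact (Subtype.val_injective.extend_apply (fun y : V => f ⟨y.1, h y.2⟩) 0 ⟨y, hy⟩).symm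

/-- The projection onto the orbit space, as a continuous map for the quotient topology. -/
def orbitProj (G X : Type*) [Group G] [TopologicalSpace X] [MulAction G X] :
    C(X, MulAction.orbitRel.Quotient G X) :=
  ⟨Quotient.mk _, continuous_quotient_mk'⟩

/-- The quotient analytic structure on the orbit space `X / G` (with the quotient topology): a
function on an open set `U` is holomorphic if and only if its pull-back to the preimage of `U` in
`X` is holomorphic. -/
noncomputable def AnalyticStructure.orbitSpace {X : Type*} [TopologicalSpace X]
    (A : AnalyticStructure X) (G : Type*) [Group G] [MulAction G X] :
    AnalyticStructure (MulAction.orbitRel.Quotient G X) where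
  holo U :=
    { carrier := {f | (fun x : Opens.comap (orbitProj G X) U => f ⟨orbitProj G X x.1, x.2⟩) ∈
        A.holo (Opens.comap (orbitProj G X) U)}
      mul_mem' := fun hf hg => Subalgebra.mul_mem _ hf hg
      add_mem' := fun hf hg => Subalgebra.add_mem _ hf hg
      algebraMap_mem' := fun c => Subalgebra.algebraMap_mem _ c }
  mem_iff_local := by
    intro U f
    constructor
    · intro hf x
      exact ⟨U, le_rfl, x.2, hf⟩
    · intro hf
      refine (A.mem_iff_local _ _).2 fun x => ?_
      obtain ⟨V, h, hx, hV⟩ := hf ⟨orbitProj G X x.1, x.2⟩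
      exact ⟨Opens.comap (orbitProj G X) V, fun y hy => h hy, hx, hV⟩

/-- The affine line `𝔸¹` over `ℂ` with its complex analytic structure. -/
noncomputable def affineLine : AnalyticStructure ℂ := .ofManifold ℂ

/-! ### Subsets of complex projective space -/

/-- The quotient topology on the projectivization of a complex vector space. -/
noncomputable instance Projectivization.complexTopology {V : Type*} [AddCommGroup V] [Module ℂ V]
    [TopologicalSpace V] : TopologicalSpace (ℙ ℂ V) :=
  TopologicalSpace.coinduced (Projectivization.mk' ℂ) inferInstance

/-- The (reduced) analytic structure induced by projective space on a subset `X`: a function on an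
open set of `X` is holomorphic if, in homogeneous coordinates, it is locally the restriction of a
holomorphic function. -/
noncomputable def AnalyticStructure.ofProjective {ι : Type*} [Fintype ι]
    (X : Set (ℙ ℂ (ι → ℂ))) : AnalyticStructure X where
  holo U :=
    { carrier := {f | ∀ (z : ι → ℂ) (hz : z ≠ 0) (hX : Projectivization.mk ℂ z hz ∈ X),
        (⟨_, hX⟩ : X) ∈ U → ∃ (W : Set (ι → ℂ)) (F : (ι → ℂ) → ℂ), IsOpen W ∧ z ∈ W ∧
          DifferentiableOn ℂ F W ∧ ∀ w ∈ W, ∀ (hw : w ≠ 0)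
            (hwX : Projectivization.mk ℂ w hw ∈ X) (hwU : (⟨_, hwX⟩ : X) ∈ U),
            F w = f ⟨_, hwU⟩}
      mul_mem' := by
        intro f g hf hg z hz hX hU
        obtain ⟨W, F, hW, hzW, hF, e⟩ := hf z hz hX hU
        obtain ⟨W', F', hW', hzW', hF', e'⟩ := hg z hz hX hU
        refine ⟨W ∩ W', F * F', hW.inter hW', ⟨hzW, hzW'⟩,
          (hF.mono Set.inter_subset_left).mul (hF'.mono Set.inter_subset_right), ?_⟩
        intro w hwW hw hwX hwU
        simp [e w hwW.1 hw hwX hwU, e' w hwW.2 hw hwX hwU]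
      add_mem' := by
        intro f g hf hg z hz hX hU
        obtain ⟨W, F, hW, hzW, hF, e⟩ := hf z hz hX hU
        obtain ⟨W', F', hW', hzW', hF', e'⟩ := hg z hz hX hU
        refine ⟨W ∩ W', F + F', hW.inter hW', ⟨hzW, hzW'⟩,
          (hF.mono Set.inter_subset_left).add (hF'.mono Set.inter_subset_right), ?_⟩
        intro w hwW hw hwX hwU
        simp [e w hwW.1 hw hwX hwU, e' w hwW.2 hw hwX hwU]
      algebraMap_mem' := fun c z _ _ _ =>
        ⟨Set.univ, fun _ => c, isOpen_univ, trivial, differentiableOn_const c,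
          fun _ _ _ _ _ => rfl⟩ }
  mem_iff_local := by
    intro U f
    constructor
    · intro hf x
      exact ⟨U, le_rfl, x.2, hf⟩
    · intro hf z hz hX hU
      obtain ⟨V, h, hx, hV⟩ := hf ⟨_, hU⟩
      obtain ⟨W, F, hW, hzW, hF, e⟩ := hV z hz hX hx
      -- shrink `W` to the vectors that are nonzero and whose class, if in `X`, lies in `V`
      obtain ⟨V', hV', hVV'⟩ := isOpen_induced_iff.1 V.isOpen
      have hO : IsOpen (Subtype.val '' (Projectivization.mk' ℂ ⁻¹' V' :
          Set {v : ι → ℂ // v ≠ 0})) :=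
        (isOpen_ne (x := (0 : ι → ℂ))).isOpenMap_subtype_val _ (isOpen_coinduced.1 hV')
      refine ⟨W ∩ Subtype.val '' (Projectivization.mk' ℂ ⁻¹' V' : Set {v : ι → ℂ // v ≠ 0}), F,
        hW.inter hO, ⟨hzW, ⟨z, hz⟩, ?_, rfl⟩, hF.mono Set.inter_subset_left, ?_⟩
      · have : (⟨_, hX⟩ : X) ∈ Subtype.val ⁻¹' V' := hVV' ▸ hx
        exact this
      · rintro w ⟨hwW, ⟨w', hw'⟩, hwV, rfl⟩ hw hwX hwU
        have : (⟨_, hwX⟩ : X) ∈ (V : Set X) := by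
          rw [← hVV']
          exact hwV
        exact e w' hwW hw hwX this

/-! ### Period domain and arithmetic group of a lattice with an isometry

A lattice is given by its Gram matrix `B` in a `ℤ`-basis indexed by `ι`, so that `T = ℤ^ι`,
`T ⊗ ℂ = ℂ^ι` and the isometry `ρ` of `T` is given by its matrix `R` (acting on columns). -/

/-- The orthogonal group `O(T)` of the lattice with Gram matrix `B`. -/
def latticeOrthogonalGroup {ι : Type*} [Fintype ι] [DecidableEq ι] (B : Matrix ι ι ℤ) :
    Subgroup (GL ι ℤ) where
  carrier := {γ | γ.val.transpose * B * γ.val = B}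
  one_mem' := by simp
  mul_mem' := by
    intro a b ha hb
    change (a.val * b.val).transpose * B * (a.val * b.val) = B
    calc (a.val * b.val).transpose * B * (a.val * b.val)
        = b.val.transpose * (a.val.transpose * B * a.val) * b.val := by
          simp only [Matrix.transpose_mul, Matrix.mul_assoc]
      _ = B := by rw [ha]; exact hb
  inv_mem' := by
    intro a ha
    change (a⁻¹).val.transpose * B * (a⁻¹).val = B
    have h1 : a.val * (a⁻¹).val = 1 := by simp
    calc (a⁻¹).val.transpose * B * (a⁻¹).val
        = (a⁻¹).val.transpose * (a.val.transpose * B * a.val) * (a⁻¹).val := by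
          rw [show a.val.transpose * B * a.val = B from ha]
      _ = (a.val * (a⁻¹).val).transpose * B * (a.val * (a⁻¹).val) := by
          simp only [Matrix.transpose_mul, Matrix.mul_assoc]
      _ = B := by rw [h1]; simp

/-- `Γ = {γ ∈ O(T) : γ ∘ ρ = ρ ∘ γ}`. -/
def isometryCentralizer {ι : Type*} [Fintype ι] [DecidableEq ι] (B R : Matrix ι ι ℤ) :
    Subgroup (GL ι ℤ) where
  carrier := {γ | γ ∈ latticeOrthogonalGroup B ∧ γ.val * R = R * γ.val}
  one_mem' := ⟨one_mem _, by simp⟩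
  mul_mem' := by
    rintro a b ⟨ha, ha'⟩ ⟨hb, hb'⟩
    refine ⟨mul_mem ha hb, ?_⟩
    rw [Units.val_mul, Matrix.mul_assoc, hb', ← Matrix.mul_assoc, ha', Matrix.mul_assoc]
  inv_mem' := by
    rintro a ⟨ha, ha'⟩
    refine ⟨inv_mem ha, ?_⟩
    have : Commute a.val R := ha'
    exact this.units_inv_left

/-- `D = {z ∈ ℙ(T ⊗ ℂ) : ρ(z) = i z, (z, z̄) > 0}`, where `(·,·)` is the `ℂ`-bilinear extension of
the form of `T`; the conditions are imposed on all nonzero vectors of the line `z`. (For a symmetric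
matrix `B` the number `(v, v̄)` is real.) -/
def periodDomain {ι : Type*} [Fintype ι] (B R : Matrix ι ι ℤ) : Set (ℙ ℂ (ι → ℂ)) :=
  {z | ∀ v ∈ z.submodule, v ≠ 0 →
    (R.map (Int.cast : ℤ → ℂ)).mulVec v = Complex.I • v ∧
    0 < (v ⬝ᵥ (B.map (Int.cast : ℤ → ℂ)).mulVec (star v)).re}

/-- The action of `GL_n(ℤ)` on `ℂⁿ = T ⊗ ℂ` by complex-linear automorphisms. -/
noncomputable def latticeAut {ι : Type*} [Fintype ι] [DecidableEq ι] :
    GL ι ℤ →* LinearMap.GeneralLinearGroup ℂ (ι → ℂ) :=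
  (Matrix.GeneralLinearGroup.toLin (n := ι) (R := ℂ)).toMonoidHom.comp
    (Matrix.GeneralLinearGroup.map (Int.castRingHom ℂ))

theorem latticeAut_apply {ι : Type*} [Fintype ι] [DecidableEq ι] (γ : GL ι ℤ) (v : ι → ℂ) :
    (latticeAut γ).val v = (γ.val.map (Int.cast : ℤ → ℂ)).mulVec v := rfl

theorem latticeAut_smul_mem_periodDomain {ι : Type*} [Fintype ι] [DecidableEq ι]
    {B R : Matrix ι ι ℤ} {γ : GL ι ℤ} (hγ : γ ∈ isometryCentralizer B R)
    {z : ℙ ℂ (ι → ℂ)} (hz : z ∈ periodDomain B R) : latticeAut γ • z ∈ periodDomain B R := by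
  obtain ⟨hB, hR⟩ := hγ
  have hB' : γ.val.transpose * B * γ.val = B := hB
  have hBC : (γ.val.map (Int.cast : ℤ → ℂ)).transpose * B.map (Int.cast : ℤ → ℂ) *
      γ.val.map (Int.cast : ℤ → ℂ) = B.map (Int.cast : ℤ → ℂ) := by
    have := congrArg (fun M : Matrix ι ι ℤ => M.map (Int.castRingHom ℂ)) hB'
    simp only [Matrix.map_mul, Matrix.transpose_map] at this
    exact this
  have hRC : γ.val.map (Int.cast : ℤ → ℂ) * R.map (Int.cast : ℤ → ℂ) =
      R.map (Int.cast : ℤ → ℂ) * γ.val.map (Int.cast : ℤ → ℂ) := by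
    have := congrArg (fun M : Matrix ι ι ℤ => M.map (Int.castRingHom ℂ)) hR
    simp only [Matrix.map_mul] at this
    exact this
  induction z using Projectivization.ind with
  | h u hu =>
    intro v hv hv0
    rw [Projectivization.smul_mk, Projectivization.submodule_mk,
      Submodule.mem_span_singleton] at hv
    obtain ⟨c, rfl⟩ := hv
    have hc : c • u ∈ (Projectivization.mk ℂ u hu).submodule := by
      rw [Projectivization.submodule_mk]
      exact Submodule.smul_mem _ _ (Submodule.mem_span_singleton_self u)
    have hc0 : c • u ≠ 0 := by
      rw [smul_ne_zero_iff]
      exact ⟨fun h => hv0 (by simp [h]), hu⟩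
    obtain ⟨h1, h2⟩ := hz _ hc hc0
    have e : c • (latticeAut γ • u) = (γ.val.map (Int.cast : ℤ → ℂ)).mulVec (c • u) := by
      rw [Matrix.mulVec_smul]; rfl
    rw [e]
    refine ⟨?_, ?_⟩
    · rw [Matrix.mulVec_mulVec, ← hRC, ← Matrix.mulVec_mulVec, h1, Matrix.mulVec_smul]
    · have hs : star ((γ.val.map (Int.cast : ℤ → ℂ)).mulVec (c • u)) =
          (γ.val.map (Int.cast : ℤ → ℂ)).mulVec (star (c • u)) := by
        ext i
        simp [Matrix.mulVec, dotProduct]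
      rw [hs, Matrix.mulVec_mulVec, Matrix.dotProduct_mulVec, Matrix.vecMul_mulVec,
        ← Matrix.mul_assoc, hBC, ← Matrix.dotProduct_mulVec]
      exact h2

/-- `Γ` acts on `D`. -/
noncomputable instance periodDomainAction {ι : Type*} [Fintype ι] [DecidableEq ι]
    (B R : Matrix ι ι ℤ) : MulAction (isometryCentralizer B R) (periodDomain B R) where
  smul γ z := ⟨latticeAut γ.1 • z.1, latticeAut_smul_mem_periodDomain γ.2 z.2⟩
  one_smul z := Subtype.ext (by
    change latticeAut (1 : GL ι ℤ) • z.1 = z.1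
    rw [map_one, one_smul])
  mul_smul γ δ z := Subtype.ext (by
    change latticeAut (γ.1 * δ.1) • z.1 = latticeAut γ.1 • latticeAut δ.1 • z.1
    rw [map_mul, mul_smul])

/-- The lattice `T = A₁ ⊕ A₁ ⊕ A₁(-1) ⊕ A₁(-1)`, by its Gram matrix in the natural basis. -/
def gramT : Matrix (Fin 4) (Fin 4) ℤ := Matrix.diagonal ![2, 2, -2, -2]

/-- The isometry `ρ` of `T`: the matrix `J = A ⊕ A` with `A = (0 -1; 1 0)`. -/
def matJ : Matrix (Fin 4) (Fin 4) ℤ :=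
  !![0, -1, 0, 0;
     1, 0, 0, 0;
     0, 0, 0, -1;
     0, 0, 1, 0]

/-- The moduli space `ℳ = D / Γ`. -/
abbrev ModuliSpace : Type :=
  MulAction.orbitRel.Quotient (isometryCentralizer gramT matJ) (periodDomain gramT matJ)

/-- The analytic structure of `ℳ = D / Γ`. -/
noncomputable def moduliAnalytic : AnalyticStructure ModuliSpace :=
  (AnalyticStructure.ofProjective (periodDomain gramT matJ)).orbitSpace
    (isometryCentralizer gramT matJ)

/-! ### The Fricke modular curve of level two -/

/-- `PSL(2, ℝ)` acts on the upper half plane by Möbius transformations. -/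
noncomputable instance pslUpperHalfPlaneAction : MulAction PSL(2, ℝ) ℍ :=
  MulAction.compHom ℍ (Matrix.ProjectiveSpecialLinearGroup.toPGL (n := Fin 2) (R := ℝ))

theorem psl_mk_smul (g : SL(2, ℝ)) (τ : ℍ) : (QuotientGroup.mk g : PSL(2, ℝ)) • τ = g • τ := rfl

/-- The natural homomorphism from `SL(2, ℤ)` to `PSL(2, ℝ)` (its image is `PSL(2, ℤ)`). -/
noncomputable def slToPSL : SL(2, ℤ) →* PSL(2, ℝ) :=
  (QuotientGroup.mk' _).comp (Matrix.SpecialLinearGroup.map (Int.castRingHom ℝ))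

/-- `H[2]`: the classes of the matrices `(a b; c d) ∈ SL(2, ℤ)` with `c ≡ 0 (mod 2)`. -/
noncomputable def levelTwo : Subgroup PSL(2, ℝ) := (CongruenceSubgroup.Gamma0 2).map slToPSL

/-- The matrix `(0 -1/√2; √2 0)`. -/
noncomputable def frickeMatrix : SL(2, ℝ) :=
  ⟨!![0, -1 / √2; √2, 0], by
    rw [Matrix.det_fin_two_of]
    have : √(2 : ℝ) ≠ 0 := by positivity
    field_simp
    norm_num⟩

/-- The Fricke involution `F`. -/
noncomputable def fricke : PSL(2, ℝ) := QuotientGroup.mk frickeMatrix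

theorem fricke_mul_self : fricke * fricke = 1 := by
  have h2 : √(2 : ℝ) ≠ 0 := by positivity
  have : frickeMatrix * frickeMatrix = -1 := by
    apply Subtype.ext
    rw [Matrix.SpecialLinearGroup.coe_mul, Matrix.SpecialLinearGroup.coe_neg,
      Matrix.SpecialLinearGroup.coe_one]
    ext i j
    fin_cases i <;> fin_cases j <;>
      simp [frickeMatrix, Matrix.mul_apply, Fin.sum_univ_two, h2, mul_div_cancel₀]
  change (QuotientGroup.mk (frickeMatrix * frickeMatrix) : PSL(2, ℝ)) = 1
  rw [this, QuotientGroup.eq_one_iff, Subgroup.mem_center_iff]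
  intro g
  ext i j
  simp

theorem fricke_conj_mem {h : PSL(2, ℝ)} (hh : h ∈ levelTwo) : fricke * h * fricke ∈ levelTwo := by
  obtain ⟨g, hg, rfl⟩ := hh
  have hg' : ((g 1 0 : ℤ) : ZMod 2) = 0 := CongruenceSubgroup.Gamma0_mem.1 hg
  obtain ⟨k, hk⟩ := (ZMod.intCast_zmod_eq_zero_iff_dvd _ 2).1 hg'
  have hk' : g.1 1 0 = 2 * k := by exact_mod_cast hk
  have hdet : g.1 0 0 * g.1 1 1 - g.1 0 1 * g.1 1 0 = 1 := by
    rw [← Matrix.det_fin_two]; exact g.2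
  let g' : SL(2, ℤ) := ⟨!![-g.1 1 1, k; 2 * g.1 0 1, -g.1 0 0], by
    rw [Matrix.det_fin_two_of]
    rw [hk'] at hdet
    linarith⟩
  refine ⟨g', ?_, ?_⟩
  · rw [SetLike.mem_coe, CongruenceSubgroup.Gamma0_mem]
    change ((2 * g.1 0 1 : ℤ) : ZMod 2) = 0
    rw [Int.cast_mul]
    have : ((2 : ℤ) : ZMod 2) = 0 := by decide
    rw [this, zero_mul]
  · change (QuotientGroup.mk (Matrix.SpecialLinearGroup.map (Int.castRingHom ℝ) g') : PSL(2, ℝ)) =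
      QuotientGroup.mk (frickeMatrix * Matrix.SpecialLinearGroup.map (Int.castRingHom ℝ) g *
        frickeMatrix)
    congr 1
    have h3 : √(2 : ℝ) * √(2 : ℝ) = 2 := Real.mul_self_sqrt (by norm_num)
    have h4 : (1 : ℝ) / √2 = √2 / 2 := by
      rw [div_eq_div_iff (by positivity) (by norm_num)]
      linarith
    have h5 : -(1 : ℝ) / √2 = -(√2 / 2) := by rw [neg_div, h4]
    have hkR : ((g.1 1 0 : ℤ) : ℝ) = 2 * k := by exact_mod_cast hk'
    have e : (Matrix.SpecialLinearGroup.map (Int.castRingHom ℝ) g).1 =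
        !![(g.1 0 0 : ℝ), (g.1 0 1 : ℝ); 2 * (k : ℝ), (g.1 1 1 : ℝ)] := by
      rw [← hkR]
      ext i j
      fin_cases i <;> fin_cases j <;> rfl
    have e' : (Matrix.SpecialLinearGroup.map (Int.castRingHom ℝ) g').1 =
        !![-(g.1 1 1 : ℝ), (k : ℝ); 2 * (g.1 0 1 : ℝ), -(g.1 0 0 : ℝ)] := by
      ext i j
      change ((g'.1 i j : ℤ) : ℝ) = _
      fin_cases i <;> fin_cases j <;> simp [g']
    apply Subtype.ext
    rw [Matrix.SpecialLinearGroup.coe_mul, Matrix.SpecialLinearGroup.coe_mul, e, e']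
    change _ = !![0, -1 / √2; √2, 0] * _ * !![0, -1 / √2; √2, 0]
    rw [h5]
    simp only [Matrix.mul_fin_two]
    ext i j
    fin_cases i <;> fin_cases j <;> simp
    · linear_combination (-(g.1 1 1 : ℝ) / 2) * h3
    · linear_combination (-(k : ℝ) / 2) * h3
    · linear_combination (-(g.1 0 1 : ℝ)) * h3
    · linear_combination (-(g.1 0 0 : ℝ) / 2) * h3

/-- The Fricke modular group `H[2]⁺ = H[2] ∪ F H[2]`. -/
noncomputable def frickeGroup : Subgroup PSL(2, ℝ) where
  carrier := {g | g ∈ levelTwo ∨ ∃ h ∈ levelTwo, g = fricke * h}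
  one_mem' := Or.inl (one_mem _)
  mul_mem' := by
    rintro a b (ha | ⟨a, ha, rfl⟩) (hb | ⟨b, hb, rfl⟩)
    · exact Or.inl (mul_mem ha hb)
    · refine Or.inr ⟨fricke * a * fricke * b, mul_mem (fricke_conj_mem ha) hb, ?_⟩
      simp only [← mul_assoc, fricke_mul_self, one_mul]
    · exact Or.inr ⟨a * b, mul_mem ha hb, by rw [mul_assoc]⟩
    · refine Or.inl ?_
      rw [← mul_assoc]
      exact mul_mem (fricke_conj_mem ha) hb
  inv_mem' := by
    have hF : fricke⁻¹ = fricke := inv_eq_of_mul_eq_one_left fricke_mul_self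
    rintro a (ha | ⟨a, ha, rfl⟩)
    · exact Or.inl (inv_mem ha)
    · refine Or.inr ⟨fricke * a⁻¹ * fricke, fricke_conj_mem (inv_mem ha), ?_⟩
      rw [mul_inv_rev, hF]
      simp only [← mul_assoc, fricke_mul_self, one_mul]

/-- The Fricke modular curve `C(2)⁺ = 𝒮 / H[2]⁺`, `𝒮` being the upper half plane. -/
abbrev FrickeCurve : Type := MulAction.orbitRel.Quotient frickeGroup ℍ

/-- The analytic structure of `C(2)⁺ = 𝒮 / H[2]⁺`. -/
noncomputable def frickeAnalytic : AnalyticStructure FrickeCurve :=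
  (AnalyticStructure.ofManifold ℍ).orbitSpace frickeGroup

/-!
The period domain and the Fricke curve are compared by a Cayley transform, and the Fricke curve is
mapped to the affine line by its Hauptmodul.

*The period domain.* The eigenspace of `ρ` for the eigenvalue `i` consists of the vectors
`(a, -i a, b, -i b)`, on which the hermitian form is a multiple of `|a|² - |b|²`, so `D` is the unit
disc `|b / a| < 1`. Regarding `T` as `ℤ[i]²`, the group `Γ` is the unitary group of `|a|² - |b|²`
over `ℤ[i]`; its elements have rows `(α, β)` and `(u β̄, u ᾱ)` with `|α|² - |β|² = 1` and `u` a power of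
`i` (`gauss_unitary_cases`). The Cayley transform taking the centre of the disc to `(1 + i) / 2` and
the boundary point `a = b` to the cusp `∞` turns the elements with `u = 1` into exactly the group
`Γ₀(2)` (`cayleyPoint_su`, `exists_eq_of_mem_Gamma0`) and the rotation `b ↦ i b` into the element
`F T⁻¹` of the nontrivial coset of `H[2]` in `H[2]⁺` (`cayleyPoint_I_mul`). Hence it matches the
orbits of the two groups.

*The Hauptmodul.* Let `h(τ) = Δ(τ) / Δ(2τ) + 2¹² Δ(2τ) / Δ(τ)`. It is holomorphic since `Δ` has no
zeros, it is invariant under `H[2]⁺`, and the product formula for `Δ` shows that `1 / h` is a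
holomorphic function of `q` with a simple zero at `q = 0` (`inv_frickeHauptmodul`,
`hasStrictDerivAt_frickeReciprocal`). As the Fricke curve has a single cusp
(`exists_isCompact_frickeGroup_orbitRel`), `h` is a proper map from the curve to `ℂ`; being also
open, it is surjective. No information on its zeros or critical points is needed for injectivity: the
values with more than one preimage form an open set, which is also closed away from the countably
many critical values and contains no value of large modulus, so it is empty
(`Function.Injective.of_isOpenMap_of_isClosedMap`). Finally a function on an open subset of `ℂ` is
holomorphic if its pull-back under `h` is
(`UpperHalfPlane.differentiableAt_of_mdifferentiableAt_comp`), by local inverses of `h` and the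
removable singularity theorem at critical values.
-/

open Filter Topology Set

/-! ### Open and closed maps that are generically locally injective -/

/-- A map that is both open and closed and locally injective over a connected dense set `Cᶜ` is
injective as soon as a single fibre over `Cᶜ` has at most one point: over `Cᶜ`, having at most one
preimage is a closed condition because the map is open, and an open condition because the map is
closed and locally injective. -/
theorem Function.Injective.of_isOpenMap_of_isClosedMap {X Y : Type*} [TopologicalSpace X]
    [TopologicalSpace Y] [T2Space X] {h : X → Y} (ho : IsOpenMap h)
    (hcl : IsClosedMap h) {C : Set Y} (hC : IsPreconnected Cᶜ) (hC' : Dense Cᶜ)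
    (hloc : ∀ x, h x ∉ C → ∃ U ∈ 𝓝 x, InjOn h U)
    {y₀ : Y} (hy₀ : y₀ ∉ C) (huniq : ∀ x x', h x = y₀ → h x' = y₀ → x = x') :
    Function.Injective h := by
  -- `S` is the set of points with several preimages
  let S : Set Y := {y | ∃ x x', x ≠ x' ∧ h x = y ∧ h x' = y}
  have hS : IsOpen S := by
    refine isOpen_iff_mem_nhds.2 ?_
    rintro y ⟨x, x', hne, hx, hx'⟩
    obtain ⟨U, V, hU, hV, hxU, hxV, hUV⟩ := t2_separation hne
    refine mem_of_superset (inter_mem ((ho U hU).mem_nhds ⟨x, hxU, hx⟩)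
      ((ho V hV).mem_nhds ⟨x', hxV, hx'⟩)) ?_
    rintro _ ⟨⟨a, ha, rfl⟩, ⟨b, hb, hab⟩⟩
    exact ⟨a, b, hUV.ne_of_mem ha hb, rfl, hab⟩
  -- over `Cᶜ` the complement of `S` is open
  have hS' : ∀ y ∉ C, y ∉ S → ∃ W : Set Y, IsOpen W ∧ y ∈ W ∧ Disjoint W S := by
    intro y hyC hyS
    obtain ⟨N, hN, hyN, hinj⟩ : ∃ N : Set X, IsOpen N ∧ h ⁻¹' {y} ⊆ N ∧ InjOn h N := by
      by_cases hne : ∃ x, h x = y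
      · obtain ⟨x, rfl⟩ := hne
        obtain ⟨U, hU, hUi⟩ := hloc x hyC
        obtain ⟨N, hNU, hN, hxN⟩ := mem_nhds_iff.1 hU
        refine ⟨N, hN, fun x' hx' => ?_, hUi.mono hNU⟩
        by_contra hx'N
        exact hyS ⟨x, x', fun e => hx'N (e ▸ hxN), rfl, hx'⟩
      · exact ⟨∅, isOpen_empty, fun x hx => hne ⟨x, hx⟩, injOn_empty _⟩
    refine ⟨(h '' Nᶜ)ᶜ, (hcl _ hN.isClosed_compl).isOpen_compl, ?_, ?_⟩
    · rintro ⟨x, hxN, hx⟩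
      exact hxN (hyN hx)
    · refine Set.disjoint_left.2 ?_
      rintro _ hW ⟨x, x', hne, rfl, hx'⟩
      have h1 : x ∈ N := by
        by_contra hx
        exact hW ⟨x, hx, rfl⟩
      have h2 : x' ∈ N := by
        by_contra hx
        exact hW ⟨x', hx, hx'⟩
      exact hne (hinj h1 h2 hx'.symm)
  -- so `S` and the interior of its complement separate `Cᶜ`
  have hSC : S ∩ Cᶜ = ∅ := by
    by_contra hne
    obtain ⟨y, -, hy1, hy2⟩ := hC S (interior Sᶜ) hS isOpen_interior (fun y hy => by
        by_cases hyS : y ∈ S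
        · exact Or.inl hyS
        · obtain ⟨W, hW, hyW, hWS⟩ := hS' y hy hyS
          exact Or.inr (mem_interior.2 ⟨W, hWS.subset_compl_right, hW, hyW⟩))
      (by rw [inter_comm]; exact nonempty_iff_ne_empty.2 hne) (by
        have hy₀S : y₀ ∉ S := fun ⟨x, x', hne, hx, hx'⟩ => hne (huniq x x' hx hx')
        obtain ⟨W, hW, hyW, hWS⟩ := hS' y₀ hy₀ hy₀S
        exact ⟨y₀, hy₀, mem_interior.2 ⟨W, hWS.subset_compl_right, hW, hyW⟩⟩)
    exact interior_subset hy2 hy1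
  intro x x' hxx'
  by_contra hne
  obtain ⟨y, hyS, hyC⟩ := hC'.inter_open_nonempty S hS ⟨h x, x, x', hne, rfl, hxx'.symm⟩
  exact (hSC ▸ ⟨hyS, hyC⟩ : y ∈ (∅ : Set Y))

theorem Function.Surjective.of_isOpenMap_of_isClosedMap {X Y : Type*} [TopologicalSpace X]
    [TopologicalSpace Y] [Nonempty X] [PreconnectedSpace Y] {h : X → Y} (ho : IsOpenMap h)
    (hcl : IsClosedMap h) : Function.Surjective h :=
  range_eq_univ.1 (IsClopen.eq_univ ⟨hcl.isClosed_range, ho.isOpen_range⟩ (range_nonempty h))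

/-! ### Isomorphisms of orbit spaces -/

/-- An isomorphism of analytic structures that matches the orbits of two groups descends to the
orbit spaces. -/
theorem AnalyticStructure.isomorphic_orbitSpace {X Y : Type*} [TopologicalSpace X]
    [TopologicalSpace Y] {A : AnalyticStructure X} {B : AnalyticStructure Y} {G H : Type*}
    [Group G] [Group H] [MulAction G X] [MulAction H Y] (e : X ≃ₜ Y)
    (he : ∀ (U : Opens Y) (f : U → ℂ), f ∈ B.holo U ↔
      (fun x : Opens.comap (e : C(X, Y)) U => f ⟨e x.1, x.2⟩) ∈
        A.holo (Opens.comap (e : C(X, Y)) U))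
    (horb : ∀ x x', MulAction.orbitRel G X x x' ↔ MulAction.orbitRel H Y (e x) (e x')) :
    (A.orbitSpace G).Isomorphic (B.orbitSpace H) := by
  let φ : MulAction.orbitRel.Quotient G X ≃ₜ MulAction.orbitRel.Quotient H Y :=
    { toEquiv := Quotient.congr e.toEquiv horb
      continuous_toFun := continuous_quot_lift _ (continuous_quotient_mk'.comp e.continuous)
      continuous_invFun := continuous_quot_lift _ (continuous_quotient_mk'.comp e.symm.continuous) }
  exact ⟨φ, fun U f => he (Opens.comap (orbitProj H Y) U) fun y => f ⟨orbitProj H Y y.1, y.2⟩⟩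

/-! ### Holomorphic functions on the upper half plane as maps to `ℂ` -/

theorem AnalyticStructure.mem_ofManifold_iff {X : Type*} [TopologicalSpace X] [ChartedSpace ℂ X]
    {U : Opens X} {f : U → ℂ} {F : X → ℂ} (hF : ∀ x : U, F x = f x) :
    f ∈ (AnalyticStructure.ofManifold X).holo U ↔
      ∀ x ∈ U, MDifferentiableAt 𝓘(ℂ, ℂ) 𝓘(ℂ, ℂ) F x := by
  have key : ∀ x ∈ U, Function.extend (Subtype.val : U → X) f 0 =ᶠ[𝓝 x] F := fun x hx => by
    filter_upwards [U.isOpen.mem_nhds hx] with y hy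
    exact (Subtype.val_injective.extend_apply f 0 ⟨y, hy⟩).trans (hF ⟨y, hy⟩).symm
  exact ⟨fun h x hx => (h ⟨x, hx⟩).congr_of_eventuallyEq (key x hx).symm,
    fun h x => (h x.1 x.2).congr_of_eventuallyEq (key x.1 x.2)⟩

namespace UpperHalfPlane

variable {h : ℍ → ℂ}

theorem analyticAt_comp_ofComplex (hh : MDifferentiable 𝓘(ℂ, ℂ) 𝓘(ℂ, ℂ) h) (τ : ℍ) :
    AnalyticAt ℂ (h ∘ ofComplex) τ :=
  (mdifferentiable_iff.1 hh).analyticAt (isOpen_upperHalfPlaneSet.mem_nhds τ.2)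

theorem isOpenMap_of_mdifferentiable (hh : MDifferentiable 𝓘(ℂ, ℂ) 𝓘(ℂ, ℂ) h)
    (hnc : ¬ ∃ c, ∀ τ, h τ = c) : IsOpenMap h := by
  have hconn : IsPreconnected upperHalfPlaneSet := (convex_halfSpace_im_gt 0).isPreconnected
  have := (AnalyticOnNhd.is_constant_or_isOpen (U := upperHalfPlaneSet) (g := h ∘ ofComplex)
    (fun z hz => analyticAt_comp_ofComplex hh ⟨z, hz⟩) hconn).resolve_left
    fun ⟨c, hc⟩ => hnc ⟨c, fun τ => by simpa using hc τ τ.2⟩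
  intro U hU
  have h2 := this ((↑) '' U) (by rintro _ ⟨τ, -, rfl⟩; exact τ.2)
    (isOpenEmbedding_coe.isOpenMap U hU)
  rw [image_image] at h2
  simpa using h2

theorem eventually_deriv_ne_zero (hh : MDifferentiable 𝓘(ℂ, ℂ) 𝓘(ℂ, ℂ) h)
    (hnc : ¬ ∃ c, ∀ τ, h τ = c) (τ : ℍ) :
    ∀ᶠ σ : ℍ in 𝓝[≠] τ, deriv (h ∘ ofComplex) σ ≠ 0 := by
  by_contra hfr
  replace hfr := (not_eventually.1 hfr).mono fun _ => not_not.1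
  have hd : MDifferentiable 𝓘(ℂ, ℂ) 𝓘(ℂ, ℂ) fun σ : ℍ => deriv (h ∘ ofComplex) σ := by
    rw [mdifferentiable_iff]
    refine ((mdifferentiable_iff.1 hh).deriv isOpen_upperHalfPlaneSet).congr fun z hz => ?_
    simp [ofComplex_apply_of_im_pos hz]
  have h0 := eq_zero_of_frequently hd (τ := τ) hfr
  refine hnc ⟨h I, fun σ => ?_⟩
  have := isOpen_upperHalfPlaneSet.is_const_of_deriv_eq_zero
    (convex_halfSpace_im_gt 0).isPreconnected (mdifferentiable_iff.1 hh)
    (fun z hz => congrFun h0 ⟨z, hz⟩) σ.2 I.2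
  simpa only [Function.comp_apply, ofComplex_apply] using this

theorem countable_setOf_deriv_eq_zero (hh : MDifferentiable 𝓘(ℂ, ℂ) 𝓘(ℂ, ℂ) h)
    (hnc : ¬ ∃ c, ∀ τ, h τ = c) : {τ : ℍ | deriv (h ∘ ofComplex) τ = 0}.Countable := by
  refine (HereditarilyLindelofSpace.isLindelof _).countable_of_isDiscrete
    (isDiscrete_iff_forall_mem_exists_isOpen.2 fun τ hτ => ?_)
  obtain ⟨U, hU, hτU, hUs⟩ := mem_nhdsWithin.1 (eventually_deriv_ne_zero hh hnc τ)
  refine ⟨U, hU, Subset.antisymm ?_ (by rintro _ rfl; exact ⟨hτU, hτ⟩)⟩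
  rintro σ ⟨hσ, hσ0⟩
  by_contra hne
  exact hUs ⟨hσ, hne⟩ hσ0

theorem exists_injOn_of_deriv_ne_zero (hh : MDifferentiable 𝓘(ℂ, ℂ) 𝓘(ℂ, ℂ) h) {τ : ℍ}
    (hτ : deriv (h ∘ ofComplex) τ ≠ 0) : ∃ U ∈ 𝓝 τ, InjOn h U := by
  have hs := (analyticAt_comp_ofComplex hh τ).hasStrictDerivAt
  have hl := (hs.hasStrictFDerivAt_equiv hτ).eventually_left_inverse
  refine ⟨_, continuous_coe.continuousAt.preimage_mem_nhds hl, fun σ hσ σ' hσ' e => ?_⟩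
  have h1 : _ = (σ : ℂ) := hσ
  have h2 : _ = (σ' : ℂ) := hσ'
  simp only [Function.comp_apply, ofComplex_apply] at h1 h2
  rw [e] at h1
  exact UpperHalfPlane.ext (h1.symm.trans h2)

theorem differentiableAt_of_mdifferentiableAt_comp_of_deriv_ne_zero
    (hh : MDifferentiable 𝓘(ℂ, ℂ) 𝓘(ℂ, ℂ) h) {f : ℂ → ℂ} {τ : ℍ}
    (hτ : deriv (h ∘ ofComplex) τ ≠ 0)
    (hf : MDifferentiableAt 𝓘(ℂ, ℂ) 𝓘(ℂ, ℂ) (f ∘ h) τ) : DifferentiableAt ℂ f (h τ) := by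
  have hs := (analyticAt_comp_ofComplex hh τ).hasStrictDerivAt
  have hr := (hs.hasStrictFDerivAt_equiv hτ).eventually_right_inverse
  have hg := (hs.to_localInverse hτ).hasDerivAt.differentiableAt
  have hga := (hs.hasStrictFDerivAt_equiv hτ).localInverse_apply_image
  rw [mdifferentiableAt_iff] at hf
  simp only [Function.comp_apply, ofComplex_apply] at hr hg hga
  have hcomp : DifferentiableAt ℂ
      ((f ∘ h ∘ ofComplex) ∘ hs.localInverse _ _ _ hτ) (h τ) := by
    refine DifferentiableAt.comp _ ?_ hg
    have : hs.localInverse _ _ _ hτ (h τ) = (τ : ℂ) := hga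
    rw [this]
    exact hf
  refine hcomp.congr_of_eventuallyEq ?_
  filter_upwards [hr] with y hy
  exact congrArg f hy.symm

/-- A function on `ℂ` is holomorphic where its pull-back under a nonconstant holomorphic function
`h` is: away from the critical points `h` has local holomorphic inverses, and the critical values
are removable singularities since the function is continuous there, `h` being open. -/
theorem differentiableAt_of_mdifferentiableAt_comp
    (hh : MDifferentiable 𝓘(ℂ, ℂ) 𝓘(ℂ, ℂ) h) (hnc : ¬ ∃ c, ∀ τ, h τ = c) {f : ℂ → ℂ} {τ : ℍ}
    (hf : ∀ᶠ σ in 𝓝 τ, MDifferentiableAt 𝓘(ℂ, ℂ) 𝓘(ℂ, ℂ) (f ∘ h) σ) :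
    DifferentiableAt ℂ f (h τ) := by
  have hmap : 𝓝 (h τ) = map h (𝓝 τ) := ((isOpenMap_of_mdifferentiable hh hnc).nhds_le τ).antisymm
    (hh τ).continuousAt
  refine (Complex.analyticAt_of_differentiable_on_punctured_nhds_of_continuousAt ?_ ?_)
    |>.differentiableAt
  · rw [eventually_nhdsWithin_iff, hmap, eventually_map]
    have h1 := eventually_nhdsWithin_iff.1 (eventually_deriv_ne_zero hh hnc τ)
    filter_upwards [h1, hf] with σ hσ hfσ hne
    exact differentiableAt_of_mdifferentiableAt_comp_of_deriv_ne_zero hh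
      (hσ fun e => hne (congrArg h e)) hfσ
  · rw [ContinuousAt, hmap, tendsto_map'_iff]
    exact hf.self_of_nhds.continuousAt

/-- The orbit space of the upper half plane under a group with a bijective holomorphic modular
function is the affine line. -/
theorem orbitSpace_isomorphic_affineLine {G : Type*} [Group G] [MulAction G ℍ]
    [ContinuousConstSMul G ℍ] (hh : MDifferentiable 𝓘(ℂ, ℂ) 𝓘(ℂ, ℂ) h)
    (hsurj : Function.Surjective h)
    (hsep : ∀ τ τ', h τ = h τ' ↔ MulAction.orbitRel G ℍ τ τ') :
    ((AnalyticStructure.ofManifold ℍ).orbitSpace G).Isomorphic affineLine := by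
  have hnc : ¬ ∃ c, ∀ τ, h τ = c := by
    rintro ⟨c, hc⟩
    obtain ⟨τ, hτ⟩ := hsurj (c + 1)
    simp [hc τ] at hτ
  have hcont : Continuous h := hh.continuous
  let φ : MulAction.orbitRel.Quotient G ℍ → ℂ := Quotient.lift h fun τ τ' e => (hsep τ τ').2 e
  have hφ : Function.Bijective φ := by
    refine ⟨?_, fun c => ?_⟩
    · rintro ⟨τ⟩ ⟨τ'⟩ e
      exact Quotient.sound ((hsep τ τ').1 e)
    · obtain ⟨τ, rfl⟩ := hsurj c
      exact ⟨Quotient.mk _ τ, rfl⟩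
  have hφo : IsOpenMap φ :=
    (MulAction.isOpenQuotientMap_quotientMk (Γ := G) (T := ℍ)).isOpenMap_iff.2
      (isOpenMap_of_mdifferentiable hh hnc)
  let e := (Equiv.ofBijective φ hφ).toHomeomorphOfContinuousOpen
    (continuous_quot_lift _ hcont) hφo
  refine ⟨e, fun U f => ?_⟩
  have e1 := AnalyticStructure.mem_ofManifold_iff (U := U) (f := f)
    (F := Function.extend Subtype.val f 0) fun x => Subtype.val_injective.extend_apply f 0 x
  have e2 := AnalyticStructure.mem_ofManifold_iff (X := ℍ)
    (U := Opens.comap (orbitProj G ℍ) (Opens.comap (e : C(_, ℂ)) U))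
    (f := fun x => f ⟨e (orbitProj G ℍ x.1), x.2⟩)
    (F := Function.extend Subtype.val f 0 ∘ h)
    fun x => Subtype.val_injective.extend_apply f 0 ⟨e (orbitProj G ℍ x.1), x.2⟩
  refine e1.trans (Iff.trans ?_ e2.symm)
  constructor
  · intro hf τ hτ
    exact (hf (h τ) hτ).comp τ (hh τ)
  · intro hf z hz
    obtain ⟨τ, rfl⟩ := hsurj z
    refine mdifferentiableAt_iff_differentiableAt.2
      (differentiableAt_of_mdifferentiableAt_comp hh hnc ?_)
    filter_upwards [(U.isOpen.preimage hcont).mem_nhds hz] with σ hσ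
    exact hf σ hσ

end UpperHalfPlane

/-! ### Orbits of the Fricke group -/

theorem slToPSL_smul (g : SL(2, ℤ)) (τ : ℍ) : slToPSL g • τ = g • τ := by
  change (Matrix.SpecialLinearGroup.map (Int.castRingHom ℝ) g) • τ = g • τ
  ext1
  rw [UpperHalfPlane.coe_specialLinearGroup_apply, UpperHalfPlane.coe_specialLinearGroup_apply]
  rfl

theorem coe_fricke_smul (τ : ℍ) : ((fricke • τ : ℍ) : ℂ) = -1 / (2 * τ) := by
  change ((frickeMatrix • τ : ℍ) : ℂ) = _
  have h2 : ((√2 : ℝ) : ℂ) * ((√2 : ℝ) : ℂ) = 2 := by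
    rw [← Complex.ofReal_mul, Real.mul_self_sqrt (by norm_num)]; simp
  have h0 : ((√2 : ℝ) : ℂ) ≠ 0 := fun h => by simp [h] at h2
  rw [UpperHalfPlane.coe_specialLinearGroup_apply]
  simp only [frickeMatrix, Matrix.of_apply, Matrix.cons_val', Matrix.cons_val_zero,
    Matrix.cons_val_one, Algebra.algebraMap_self_apply, Complex.ofReal_zero, zero_mul, zero_add,
    add_zero, Matrix.cons_val_fin_one, Complex.ofReal_div, Complex.ofReal_neg, Complex.ofReal_one]
  rw [← h2, div_div, mul_assoc]

theorem frickeGroup_orbitRel_iff {τ τ' : ℍ} : MulAction.orbitRel frickeGroup ℍ τ τ' ↔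
    ∃ g ∈ CongruenceSubgroup.Gamma0 2, τ = g • τ' ∨ τ = fricke • (g • τ') := by
  rw [MulAction.orbitRel_apply]
  constructor
  · rintro ⟨⟨_, ⟨g, hg, rfl⟩ | ⟨_, ⟨g, hg, rfl⟩, rfl⟩⟩, rfl⟩
    · exact ⟨g, hg, Or.inl (slToPSL_smul g τ')⟩
    · refine ⟨g, hg, Or.inr ?_⟩
      rw [← slToPSL_smul g τ', ← mul_smul]
      rfl
  · rintro ⟨g, hg, rfl | rfl⟩
    · exact ⟨⟨slToPSL g, Or.inl ⟨g, hg, rfl⟩⟩, slToPSL_smul g τ'⟩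
    · refine ⟨⟨fricke * slToPSL g, Or.inr ⟨_, ⟨g, hg, rfl⟩, rfl⟩⟩, ?_⟩
      change (fricke * slToPSL g) • τ' = _
      rw [mul_smul, slToPSL_smul]

instance : ContinuousConstSMul PSL(2, ℝ) ℍ where
  continuous_const_smul γ := by
    obtain ⟨g, rfl⟩ := QuotientGroup.mk_surjective γ
    exact (continuous_const_smul g : Continuous fun τ : ℍ => g • τ)

theorem finite_setOf_sl_smul_inter_nonempty {K L : Set ℍ} (hK : IsCompact K) (hL : IsCompact L) :
    {g : SL(2, ℤ) | ((fun τ => g • τ) '' K ∩ L).Nonempty}.Finite := by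
  have h := (Subgroup.properlyDiscontinuousSMul_iff _).1 properlyDiscontinuousSL2ZRange hK hL
  refine (h.preimage (f := Matrix.SpecialLinearGroup.mapGL ℝ)
    Matrix.SpecialLinearGroup.mapGL_injective.injOn).subset ?_
  intro g hg
  exact ⟨⟨g, rfl⟩, hg⟩

instance : ContinuousConstSMul frickeGroup ℍ where
  continuous_const_smul γ := continuous_const_smul γ.1

/-- The Fricke group acts properly discontinuously because `SL(2, ℤ)` does and `H[2]` has index two
in it. -/
instance frickeGroup_properlyDiscontinuousSMul : ProperlyDiscontinuousSMul frickeGroup ℍ where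
  finite_disjoint_inter_image := by
    intro K L hK hL
    have hL' : IsCompact ((fun τ : ℍ => fricke • τ) '' L) :=
      hL.image (continuous_const_smul fricke)
    have h1 := (finite_setOf_sl_smul_inter_nonempty hK hL).image slToPSL
    have h2 := ((finite_setOf_sl_smul_inter_nonempty hK hL').image slToPSL).image (fricke * ·)
    refine ((h1.union h2).preimage (f := (Subtype.val : frickeGroup → PSL(2, ℝ)))
      Subtype.val_injective.injOn).subset ?_
    rintro ⟨_, ⟨g, hg, rfl⟩ | ⟨_, ⟨g, hg, rfl⟩, rfl⟩⟩ ⟨_, ⟨τ, hτ, rfl⟩, hτL⟩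
    · exact Or.inl ⟨g, ⟨g • τ, ⟨τ, hτ, rfl⟩, by rw [← slToPSL_smul]; exact hτL⟩, rfl⟩
    · refine Or.inr ⟨_, ⟨g, ⟨g • τ, ⟨τ, hτ, rfl⟩, ⟨_, hτL, ?_⟩⟩, rfl⟩, rfl⟩
      change fricke • ((fricke * slToPSL g) • τ) = _
      rw [mul_smul, ← mul_smul fricke, fricke_mul_self, one_smul, slToPSL_smul]

theorem coe_fricke_smul_S_smul (τ : ℍ) :
    ((fricke • (ModularGroup.S • τ) : ℍ) : ℂ) = τ / 2 := by
  rw [coe_fricke_smul, UpperHalfPlane.modular_S_smul]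
  have := τ.ne_zero
  simp only [inv_neg]
  field_simp

/-- The three cosets of `Γ₀(2)` in `SL(2, ℤ)` are represented by `1`, `S` and `S T`. -/
theorem exists_mem_fd_frickeGroup_orbitRel (τ : ℍ) : ∃ τ' ∈ ModularGroup.fd,
    MulAction.orbitRel frickeGroup ℍ τ τ' ∨
    MulAction.orbitRel frickeGroup ℍ τ (fricke • (ModularGroup.S • τ')) ∨
    MulAction.orbitRel frickeGroup ℍ τ (fricke • (ModularGroup.S • (ModularGroup.T • τ'))) := by
  obtain ⟨g, hg⟩ := ModularGroup.exists_smul_mem_fd τ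
  obtain ⟨k, hk⟩ : ∃ k : SL(2, ℤ), τ = k • (g • τ) := ⟨g⁻¹, by simp⟩
  refine ⟨_, hg, ?_⟩
  generalize g • τ = τ' at hk
  subst hk
  -- `σ = F F σ` is related to `F σ`
  have hF : ∀ k ∈ CongruenceSubgroup.Gamma0 2, ∀ σ : ℍ,
      MulAction.orbitRel frickeGroup ℍ (k • σ) (fricke • σ) := by
    intro k hk σ
    refine Setoid.trans' _ (frickeGroup_orbitRel_iff.2 ⟨k, hk, Or.inl rfl⟩)
      (Setoid.symm' _ (frickeGroup_orbitRel_iff.2 ⟨1, one_mem _, Or.inr ?_⟩))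
    rw [one_smul]
  have hdet : k 0 0 * k 1 1 - k 0 1 * k 1 0 = 1 := by
    rw [← Matrix.det_fin_two]; exact k.2
  rcases Int.even_or_odd (k 1 0) with hc | hc
  · refine Or.inl (frickeGroup_orbitRel_iff.2 ⟨k, ?_, Or.inl rfl⟩)
    rw [CongruenceSubgroup.Gamma0_mem]
    exact (ZMod.intCast_zmod_eq_zero_iff_dvd _ 2).2 hc.two_dvd
  rcases Int.even_or_odd (k 1 1) with hd | hd
  · refine Or.inr (Or.inl ?_)
    have := hF (k * ModularGroup.S⁻¹) ?_ (ModularGroup.S • τ')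
    · rwa [mul_smul, inv_smul_smul] at this
    · rw [CongruenceSubgroup.Gamma0_mem]
      refine (ZMod.intCast_zmod_eq_zero_iff_dvd _ 2).2 ?_
      have e : (k * ModularGroup.S⁻¹) 1 0 = -k 1 1 := by
        simp [ModularGroup.coe_S, Matrix.mul_apply, Fin.sum_univ_two, Matrix.adjugate_fin_two]
      rw [e]
      exact (dvd_neg (α := ℤ)).2 hd.two_dvd
  · refine Or.inr (Or.inr ?_)
    have := hF (k * ModularGroup.T⁻¹ * ModularGroup.S⁻¹) ?_
      (ModularGroup.S • (ModularGroup.T • τ'))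
    · rwa [mul_smul, inv_smul_smul, mul_smul, inv_smul_smul] at this
    · rw [CongruenceSubgroup.Gamma0_mem]
      refine (ZMod.intCast_zmod_eq_zero_iff_dvd _ 2).2 ?_
      have e : (k * ModularGroup.T⁻¹ * ModularGroup.S⁻¹) 1 0 = k 1 0 - k 1 1 := by
        simp [ModularGroup.coe_S, ModularGroup.coe_T, Matrix.mul_apply, Fin.sum_univ_two,
          Matrix.adjugate_fin_two]
        ring
      rw [e]
      exact (hc.sub_odd hd).two_dvd

/-- The orbit space of the Fricke group has one cusp: a set of representatives meets every
half plane `Im τ ≤ M` in a relatively compact set. -/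
theorem exists_isCompact_frickeGroup_orbitRel : ∃ K : ℝ → Set ℍ, (∀ M, IsCompact (K M)) ∧
    ∀ τ, ∃ τ', MulAction.orbitRel frickeGroup ℍ τ τ' ∧ ∀ M, τ'.im ≤ M → τ' ∈ K M := by
  let ψ : ℍ → ℍ := fun τ => fricke • (ModularGroup.S • τ)
  have hψ : ∀ τ, (ψ τ).im = τ.im / 2 := fun τ => by
    rw [← UpperHalfPlane.coe_im, coe_fricke_smul_S_smul]
    simp
  have hS : Continuous fun τ : ℍ => ModularGroup.S • τ := by
    simp only [← slToPSL_smul]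
    exact continuous_const_smul _
  have hT : Continuous fun τ : ℍ => ModularGroup.T • τ := by
    simp only [← slToPSL_smul]
    exact continuous_const_smul _
  have hψc : Continuous ψ := (continuous_const_smul fricke).comp hS
  let Q : ℝ → Set ℍ := fun M => ModularGroup.truncatedFundamentalDomain (2 * M)
  have hQ : ∀ M, IsCompact (Q M) := fun M => ModularGroup.isCompact_truncatedFundamentalDomain _
  refine ⟨fun M => Q M ∪ ψ '' Q M ∪ (fun τ => ψ (ModularGroup.T • τ)) '' Q M, fun M =>
    ((hQ M).union ((hQ M).image hψc)).union ((hQ M).image (hψc.comp hT)), fun τ => ?_⟩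
  obtain ⟨τ', hfd, h | h | h⟩ := exists_mem_fd_frickeGroup_orbitRel τ
  · refine ⟨_, h, fun M hM => Or.inl (Or.inl ⟨hfd, ?_⟩)⟩
    linarith [τ'.im_pos]
  · refine ⟨_, h, fun M hM => Or.inl (Or.inr ⟨τ', ⟨hfd, ?_⟩, rfl⟩)⟩
    have : (ψ τ').im ≤ M := hM
    rw [hψ] at this
    linarith
  · refine ⟨_, h, fun M hM => Or.inr ⟨τ', ⟨hfd, ?_⟩, rfl⟩⟩
    have : (ψ (ModularGroup.T • τ')).im ≤ M := hM
    rw [hψ, ModularGroup.im_T_smul] at this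
    linarith

/-! ### The Hauptmodul -/

namespace UpperHalfPlane

/-- The point `2τ` of the upper half plane. -/
def double (τ : ℍ) : ℍ := ⟨2 * τ, by simpa using τ.im_pos⟩

@[simp] theorem coe_double (τ : ℍ) : (τ.double : ℂ) = 2 * τ := rfl

end UpperHalfPlane

open ModularForm in
theorem discriminant_smul (g : SL(2, ℤ)) (τ : ℍ) :
    discriminant (g • τ) = ((g 1 0 : ℂ) * τ + g 1 1) ^ 12 * discriminant τ := by
  have h := congrFun
    (SlashInvariantForm.slash_action_generators_SL2Z discriminant_S_invariant
      discriminant_T_invariant g) τ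
  rw [SL_slash_apply] at h
  have hd : UpperHalfPlane.denom g τ = (g 1 0 : ℂ) * τ + g 1 1 := by
    rw [ModularGroup.denom_apply]
  have h0 : UpperHalfPlane.denom g τ ≠ 0 := UpperHalfPlane.denom_ne_zero _ _
  rw [← h, ← hd, mul_comm, mul_assoc, zpow_neg, ← zpow_natCast]
  simp [h0]

open ModularForm in
/-- The function `Δ(τ) / Δ(2τ) + 2¹² Δ(2τ) / Δ(τ)`. Each quotient is invariant under `Γ₀(2)`, and
the Fricke involution `τ ↦ -1 / (2τ)` interchanges the two summands. -/
noncomputable def frickeHauptmodul (τ : ℍ) : ℂ :=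
  discriminant τ / discriminant τ.double + 4096 * (discriminant τ.double / discriminant τ)

open ModularForm in
theorem frickeHauptmodul_fricke_smul (τ : ℍ) :
    frickeHauptmodul (fricke • τ) = frickeHauptmodul τ := by
  -- `2 (F τ) = S τ` and `F τ = S (2 τ)`
  have e1 : (fricke • τ).double = ModularGroup.S • τ := by
    ext1
    rw [UpperHalfPlane.coe_double, coe_fricke_smul, UpperHalfPlane.modular_S_smul]
    have := τ.ne_zero
    simp only [inv_neg]
    field_simp
  have e2 : fricke • τ = ModularGroup.S • τ.double := by
    ext1
    rw [coe_fricke_smul, UpperHalfPlane.modular_S_smul]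
    have := τ.ne_zero
    simp only [inv_neg, UpperHalfPlane.coe_double]
    field_simp
  have h1 : discriminant (fricke • τ).double = (τ : ℂ) ^ 12 * discriminant τ := by
    rw [e1, discriminant_smul]
    simp [ModularGroup.S]
  have h2 : discriminant (fricke • τ) = (2 * (τ : ℂ)) ^ 12 * discriminant τ.double := by
    rw [e2, discriminant_smul]
    simp [ModularGroup.S]
  have := τ.ne_zero
  have := discriminant_ne_zero τ
  have := discriminant_ne_zero τ.double
  rw [frickeHauptmodul, frickeHauptmodul, h1, h2]
  field_simp
  ring

open ModularForm in
theorem frickeHauptmodul_smul {g : SL(2, ℤ)} (hg : g ∈ CongruenceSubgroup.Gamma0 2) (τ : ℍ) :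
    frickeHauptmodul (g • τ) = frickeHauptmodul τ := by
  obtain ⟨k, hk⟩ := (ZMod.intCast_zmod_eq_zero_iff_dvd _ 2).1 (CongruenceSubgroup.Gamma0_mem.1 hg)
  have hk : g 1 0 = 2 * k := hk
  have hdet : g 0 0 * g 1 1 - g 0 1 * g 1 0 = 1 := by
    rw [← Matrix.det_fin_two]; exact g.2
  -- `2 (g τ) = g' (2 τ)`
  let g' : SL(2, ℤ) := ⟨!![g 0 0, 2 * g 0 1; k, g 1 1], by
    rw [Matrix.det_fin_two_of]
    rw [hk] at hdet
    linarith⟩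
  have hkC : ((g 1 0 : ℤ) : ℂ) = 2 * k := by rw [hk]; push_cast; rfl
  have e : (g • τ).double = g' • τ.double := by
    ext1
    rw [UpperHalfPlane.coe_double, UpperHalfPlane.coe_specialLinearGroup_apply,
      UpperHalfPlane.coe_specialLinearGroup_apply]
    simp only [g', algebraMap_int_eq, eq_intCast, Complex.ofReal_intCast, hkC, Matrix.of_apply,
      Matrix.cons_val', Matrix.cons_val_zero, Matrix.cons_val_one, Matrix.cons_val_fin_one,
      UpperHalfPlane.coe_double, Int.cast_mul, Int.cast_ofNat]
    rw [mul_div_assoc']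
    push_cast
    congr 1 <;> ring
  have h1 : discriminant (g • τ).double =
      ((g 1 0 : ℂ) * τ + g 1 1) ^ 12 * discriminant τ.double := by
    rw [e, discriminant_smul, hkC]
    simp only [g', Matrix.of_apply, Matrix.cons_val', Matrix.cons_val_zero, Matrix.cons_val_one,
      Matrix.cons_val_fin_one, UpperHalfPlane.coe_double]
    ring
  have h0 : ((g 1 0 : ℂ) * τ + g 1 1) ^ 12 ≠ 0 := by
    intro h
    have := discriminant_smul g τ
    rw [h, zero_mul] at this
    exact discriminant_ne_zero _ this
  rw [frickeHauptmodul, frickeHauptmodul, h1, discriminant_smul, mul_div_mul_left _ _ h0,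
    mul_div_mul_left _ _ h0]

theorem frickeHauptmodul_eq_of_orbitRel {τ τ' : ℍ}
    (h : MulAction.orbitRel frickeGroup ℍ τ τ') : frickeHauptmodul τ = frickeHauptmodul τ' := by
  obtain ⟨g, hg, rfl | rfl⟩ := frickeGroup_orbitRel_iff.1 h
  · exact frickeHauptmodul_smul hg τ'
  · rw [frickeHauptmodul_fricke_smul, frickeHauptmodul_smul hg]

open ModularForm in
theorem mdifferentiable_frickeHauptmodul :
    MDifferentiable 𝓘(ℂ, ℂ) 𝓘(ℂ, ℂ) frickeHauptmodul := by
  have h1 : ∀ z : ℂ, 0 < z.im → DifferentiableAt ℂ (fun z => eta z ^ 24) z := fun z hz =>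
    (differentiableAt_eta_of_mem_upperHalfPlaneSet hz).pow 24
  have h2 : ∀ z : ℂ, 0 < z.im → DifferentiableAt ℂ (fun z => eta (2 * z) ^ 24) z := fun z hz =>
    (h1 (2 * z) (by simpa using hz)).comp z (by fun_prop)
  rw [UpperHalfPlane.mdifferentiable_iff]
  have h3 : DifferentiableOn ℂ (fun z => eta z ^ 24 / eta (2 * z) ^ 24 +
      4096 * (eta (2 * z) ^ 24 / eta z ^ 24)) UpperHalfPlane.upperHalfPlaneSet := by
    intro z hz
    have n1 : eta z ^ 24 ≠ 0 := pow_ne_zero _ (eta_ne_zero hz)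
    have n2 : eta (2 * z) ^ 24 ≠ 0 := pow_ne_zero _ (eta_ne_zero (by
      simpa [UpperHalfPlane.upperHalfPlaneSet] using hz))
    exact (((h1 z hz).fun_div (h2 z hz) n2).add
      (((h2 z hz).fun_div (h1 z hz) n1).const_mul 4096)).differentiableWithinAt
  refine h3.congr fun z hz => ?_
  simp [frickeHauptmodul, discriminant, UpperHalfPlane.ofComplex_apply_of_im_pos hz]

/-- The product `∏ (1 - qⁿ)²⁴` over `n ≥ 1`. -/
noncomputable def eulerProd (q : ℂ) : ℂ := ∏' n : ℕ, (1 - q ^ (n + 1)) ^ 24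

theorem eulerProd_zero : eulerProd 0 = 1 := by simp [eulerProd]

theorem analyticAt_eulerProd_zero : AnalyticAt ℂ eulerProd 0 :=
  (ModularForm.differentiableOn_tprod_one_sub_pow_pow 24).analyticAt
    (Metric.isOpen_ball.mem_nhds (by simp))

/-- The reciprocal of the Hauptmodul as a function of `q`. -/
noncomputable def frickeReciprocal (q : ℂ) : ℂ :=
  q * (eulerProd q * eulerProd (q ^ 2) /
    (eulerProd q ^ 2 + 4096 * q ^ 2 * eulerProd (q ^ 2) ^ 2))

/-- The Hauptmodul has a simple pole at the cusp. -/
theorem hasStrictDerivAt_frickeReciprocal : HasStrictDerivAt frickeReciprocal 1 0 := by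
  have h1 := analyticAt_eulerProd_zero
  have h2 : AnalyticAt ℂ (fun q : ℂ => eulerProd (q ^ 2)) 0 :=
    AnalyticAt.fun_comp (g := eulerProd) (by simpa using h1) (analyticAt_id.pow 2)
  have h3 : AnalyticAt ℂ (fun q => eulerProd q * eulerProd (q ^ 2) /
      (eulerProd q ^ 2 + 4096 * q ^ 2 * eulerProd (q ^ 2) ^ 2)) 0 :=
    (h1.mul h2).div ((h1.pow 2).add ((analyticAt_const.mul (analyticAt_id.pow 2)).mul (h2.pow 2)))
      (by simp [eulerProd_zero])
  have h4 := (hasStrictDerivAt_id (0 : ℂ)).mul h3.hasStrictDerivAt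
  simpa [eulerProd_zero] using! h4

open ModularForm Function in
theorem inv_frickeHauptmodul (τ : ℍ) :
    (frickeHauptmodul τ)⁻¹ = frickeReciprocal (Periodic.qParam 1 τ) := by
  have hq : Periodic.qParam 1 (τ.double : ℂ) = Periodic.qParam 1 τ ^ 2 := by
    simp only [Periodic.qParam, UpperHalfPlane.coe_double, ← Complex.exp_nat_mul]
    congr 1
    push_cast
    ring
  have h1 : discriminant τ = Periodic.qParam 1 τ * eulerProd (Periodic.qParam 1 τ) :=
    discriminant_eq_q_prod τ
  have h2 : discriminant τ.double =
      Periodic.qParam 1 τ ^ 2 * eulerProd (Periodic.qParam 1 τ ^ 2) := by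
    rw [← hq]
    exact discriminant_eq_q_prod τ.double
  have n1 := discriminant_ne_zero τ
  have n2 := discriminant_ne_zero τ.double
  rw [h1] at n1
  rw [h2] at n2
  rw [frickeHauptmodul, frickeReciprocal, h1, h2]
  generalize Periodic.qParam 1 (τ : ℂ) = q at *
  generalize eulerProd (q ^ 2) = P₂ at *
  generalize eulerProd q = P at *
  obtain ⟨q0, p0⟩ := mul_ne_zero_iff.1 n1
  have p20 := (mul_ne_zero_iff.1 n2).2
  have : q * P / (q ^ 2 * P₂) + 4096 * (q ^ 2 * P₂ / (q * P)) =
      (P ^ 2 + 4096 * q ^ 2 * P₂ ^ 2) / (q * (P * P₂)) := by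
    field_simp
  rw [this, inv_div, mul_div_assoc]

open Function in
theorem tendsto_qParam_atImInfty_nhdsNE :
    Tendsto (fun τ : ℍ => Periodic.qParam 1 τ) UpperHalfPlane.atImInfty (𝓝[≠] 0) :=
  tendsto_nhdsWithin_iff.2 ⟨UpperHalfPlane.qParam_tendsto_atImInfty one_pos,
    Eventually.of_forall fun _ => Periodic.qParam_ne_zero _⟩

theorem tendsto_frickeHauptmodul_atImInfty :
    Tendsto frickeHauptmodul UpperHalfPlane.atImInfty (Bornology.cobounded ℂ) := by
  have h1 : Tendsto frickeReciprocal (𝓝[≠] 0) (𝓝[≠] 0) := by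
    simpa [frickeReciprocal] using
      hasStrictDerivAt_frickeReciprocal.hasDerivAt.tendsto_nhdsNE one_ne_zero
  have h2 := tendsto_inv₀_nhdsNE_zero.comp (h1.comp tendsto_qParam_atImInfty_nhdsNE)
  refine h2.congr fun τ => ?_
  simp [← inv_frickeHauptmodul]

open Function in
/-- The Hauptmodul is injective near the cusp: its reciprocal is a locally invertible function of
`q`, and `q` determines `τ` up to translation by an integer. -/
theorem exists_forall_orbitRel_of_frickeHauptmodul_eq : ∃ A : ℝ, ∀ τ τ' : ℍ, A ≤ τ.im →
    A ≤ τ'.im → frickeHauptmodul τ = frickeHauptmodul τ' →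
    MulAction.orbitRel frickeGroup ℍ τ τ' := by
  have hl := (hasStrictDerivAt_frickeReciprocal.hasStrictFDerivAt_equiv
    one_ne_zero).eventually_left_inverse
  have h1 := (UpperHalfPlane.qParam_tendsto_atImInfty one_pos).eventually hl
  obtain ⟨A, hA⟩ := UpperHalfPlane.atImInfty_mem _ |>.1 h1
  refine ⟨A, fun τ τ' hτ hτ' e => ?_⟩
  have e1 := hA τ hτ
  have e2 := hA τ' hτ'
  simp only [mem_ofPred_eq, ← inv_frickeHauptmodul] at e1 e2
  rw [e] at e1
  have hq := e1.symm.trans e2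
  obtain ⟨n, hn⟩ := (Periodic.qParam_left_inv_mod_period one_ne_zero (τ : ℂ))
  obtain ⟨n', hn'⟩ := (Periodic.qParam_left_inv_mod_period one_ne_zero (τ' : ℂ))
  rw [hq] at hn
  refine frickeGroup_orbitRel_iff.2 ⟨ModularGroup.T ^ (n' - n), ?_, Or.inl ?_⟩
  · simp [CongruenceSubgroup.Gamma0_mem, ModularGroup.coe_T_zpow]
  · ext1
    rw [ModularGroup.coe_T_zpow_smul_eq]
    rw [hn] at hn'
    push_cast at hn' ⊢
    linear_combination hn'

theorem continuous_frickeHauptmodul : Continuous frickeHauptmodul :=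
  mdifferentiable_frickeHauptmodul.continuous

theorem not_exists_frickeHauptmodul_eq_const : ¬ ∃ c, ∀ τ, frickeHauptmodul τ = c := by
  rintro ⟨c, hc⟩
  obtain ⟨τ, hτ⟩ := (tendsto_frickeHauptmodul_atImInfty.eventually
    (Bornology.isBounded_def.1 (Bornology.isBounded_singleton (x := c)))).exists
  exact hτ (hc τ)

/-- The Hauptmodul as a function on the Fricke modular curve. -/
noncomputable def frickeCurveToComplex : FrickeCurve → ℂ :=
  Quotient.lift frickeHauptmodul fun _ _ => frickeHauptmodul_eq_of_orbitRel

/-- Properness holds because the Hauptmodul tends to infinity at the only cusp. -/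
theorem isProperMap_frickeCurveToComplex : IsProperMap frickeCurveToComplex := by
  have hcont : Continuous frickeCurveToComplex := continuous_quot_lift _ continuous_frickeHauptmodul
  refine isProperMap_iff_isCompact_preimage.2 ⟨hcont, fun Z hZ => ?_⟩
  obtain ⟨K, hK, hrep⟩ := exists_isCompact_frickeGroup_orbitRel
  obtain ⟨M, hM⟩ := UpperHalfPlane.atImInfty_mem _ |>.1
    (tendsto_frickeHauptmodul_atImInfty (Bornology.isBounded_def.1 hZ.isBounded))
  refine ((hK M).image (continuous_quotient_mk' (s := MulAction.orbitRel frickeGroup ℍ)))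
    |>.of_isClosed_subset (hZ.isClosed.preimage hcont) ?_
  rintro ⟨τ⟩ hτ
  obtain ⟨τ', hττ', hτ'⟩ := hrep τ
  refine ⟨τ', hτ' M ?_, Quotient.sound (Setoid.symm' _ hττ')⟩
  by_contra hlt
  refine hM τ' (not_le.1 hlt).le ?_
  rw [← frickeHauptmodul_eq_of_orbitRel hττ']
  exact hτ

theorem isOpenMap_frickeCurveToComplex : IsOpenMap frickeCurveToComplex :=
  (MulAction.isOpenQuotientMap_quotientMk (Γ := frickeGroup) (T := ℍ)).isOpenMap_iff.2
    (UpperHalfPlane.isOpenMap_of_mdifferentiable mdifferentiable_frickeHauptmodul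
      not_exists_frickeHauptmodul_eq_const)

/-- The critical values are countable, so that `Function.Injective.of_isOpenMap_of_isClosedMap`
applies; the fibre with a single point is that of a value of large modulus. -/
theorem injective_frickeCurveToComplex : Function.Injective frickeCurveToComplex := by
  have hdiff := mdifferentiable_frickeHauptmodul
  have hnc := not_exists_frickeHauptmodul_eq_const
  -- the critical values
  let C : Set ℂ := frickeHauptmodul ''
    {τ : ℍ | deriv (frickeHauptmodul ∘ UpperHalfPlane.ofComplex) τ = 0}
  have hC : C.Countable := (UpperHalfPlane.countable_setOf_deriv_eq_zero hdiff hnc).image _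
  have hCd : Dense Cᶜ := hC.dense_compl ℂ
  -- a value of large modulus is only taken near the cusp
  obtain ⟨A, hA⟩ := exists_forall_orbitRel_of_frickeHauptmodul_eq
  obtain ⟨K, hK, hrep⟩ := exists_isCompact_frickeGroup_orbitRel
  have hb : Bornology.IsBounded (frickeHauptmodul '' K A) :=
    ((hK A).image continuous_frickeHauptmodul).isBounded
  obtain ⟨r, hr⟩ := hb.subset_closedBall 0
  obtain ⟨y₀, hy₀r, hy₀⟩ := hCd.inter_open_nonempty (Metric.closedBall 0 r)ᶜ
    Metric.isClosed_closedBall.isOpen_compl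
    (nonempty_compl.2 fun h => NormedSpace.unbounded_univ ℂ ℂ (h ▸ Metric.isBounded_closedBall))
  have hnear : ∀ τ, frickeHauptmodul τ = y₀ →
      ∃ τ', MulAction.orbitRel frickeGroup ℍ τ τ' ∧ A ≤ τ'.im ∧ frickeHauptmodul τ' = y₀ := by
    intro τ hτ
    obtain ⟨τ', hττ', hτ'⟩ := hrep τ
    have e := frickeHauptmodul_eq_of_orbitRel hττ'
    refine ⟨τ', hττ', ?_, e ▸ hτ⟩
    by_contra hlt
    exact hy₀r (hr ⟨τ', hτ' A (not_le.1 hlt).le, e ▸ hτ⟩)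
  refine Function.Injective.of_isOpenMap_of_isClosedMap isOpenMap_frickeCurveToComplex
    isProperMap_frickeCurveToComplex.isClosedMap
    (hC.isConnected_compl_of_one_lt_rank (by simp)).isPreconnected hCd ?_ hy₀ ?_
  · rintro ⟨τ⟩ hτ
    obtain ⟨U, hU, hUi⟩ := UpperHalfPlane.exists_injOn_of_deriv_ne_zero hdiff (τ := τ)
      fun h => hτ ⟨τ, h, rfl⟩
    refine ⟨Quotient.mk _ '' U,
      (MulAction.isOpenQuotientMap_quotientMk (Γ := frickeGroup)).isOpenMap.image_mem_nhds hU, ?_⟩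
    rintro _ ⟨σ, hσ, rfl⟩ _ ⟨σ', hσ', rfl⟩ e
    rw [hUi hσ hσ' e]
  · rintro ⟨τ⟩ ⟨τ'⟩ hτ hτ'
    obtain ⟨σ, hσ, hσA, hσy⟩ := hnear τ hτ
    obtain ⟨σ', hσ', hσA', hσy'⟩ := hnear τ' hτ'
    exact Quotient.sound (Setoid.trans' _ hσ (Setoid.trans' _ (hA σ σ' hσA hσA'
      (hσy.trans hσy'.symm)) (Setoid.symm' _ hσ')))

theorem frickeAnalytic_isomorphic_affineLine : frickeAnalytic.Isomorphic affineLine := by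
  refine UpperHalfPlane.orbitSpace_isomorphic_affineLine mdifferentiable_frickeHauptmodul
    (fun c => ?_) fun τ τ' => ⟨fun h => ?_, frickeHauptmodul_eq_of_orbitRel⟩
  · obtain ⟨⟨τ⟩, hτ⟩ := Function.Surjective.of_isOpenMap_of_isClosedMap
      isOpenMap_frickeCurveToComplex isProperMap_frickeCurveToComplex.isClosedMap c
    exact ⟨τ, hτ⟩
  · exact Quotient.exact (injective_frickeCurveToComplex
      (a₁ := Quotient.mk _ τ) (a₂ := Quotient.mk _ τ') h)

/-! ### The Cayley transform -/

/-- The Cayley transform from the disc `|b| < |a|` in homogeneous coordinates to the upper half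
plane; it sends the centre `b = 0` to the fixed point `(1 + i) / 2` of an element of order four of
the Fricke group, and the boundary point `a = b` to the cusp `∞`. -/
noncomputable def cayleyCoord (a b : ℂ) : ℂ :=
  ((1 + Complex.I) * a + (Complex.I - 1) * b) / (2 * (a - b))

theorem sub_ne_zero_of_normSq_lt {a b : ℂ} (h : Complex.normSq b < Complex.normSq a) :
    a - b ≠ 0 :=
  sub_ne_zero.2 fun e => h.ne (e ▸ rfl)

theorem cayleyCoord_smul {c : ℂ} (hc : c ≠ 0) (a b : ℂ) :
    cayleyCoord (c * a) (c * b) = cayleyCoord a b := by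
  rw [cayleyCoord, cayleyCoord, ← mul_div_mul_left _ (2 * (a - b)) hc]
  congr 1 <;> ring

theorem cayleyCoord_im (a b : ℂ) : (cayleyCoord a b).im =
    (Complex.normSq a - Complex.normSq b) / (2 * Complex.normSq (a - b)) := by
  by_cases h : a - b = 0
  · simp [cayleyCoord, h]
  have h0 : Complex.normSq (a - b) ≠ 0 := (Complex.normSq_pos.2 h).ne'
  rw [cayleyCoord, Complex.div_im, Complex.normSq_mul]
  have h2 : Complex.normSq 2 = 4 := by norm_num [Complex.normSq_apply]
  rw [h2]
  field_simp
  simp [Complex.normSq_apply]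
  ring

/-- The point of the upper half plane with homogeneous disc coordinates `(a, b)`. -/
noncomputable def cayleyPoint (a b : ℂ) (h : Complex.normSq b < Complex.normSq a) : ℍ :=
  ⟨cayleyCoord a b, by
    rw [cayleyCoord_im]
    have := Complex.normSq_pos.2 (sub_ne_zero_of_normSq_lt h)
    exact div_pos (sub_pos.2 h) (by positivity)⟩

@[simp] theorem coe_cayleyPoint (a b : ℂ) (h : Complex.normSq b < Complex.normSq a) :
    (cayleyPoint a b h : ℂ) = cayleyCoord a b := rfl

theorem cayleyPoint_congr {a b a' b' : ℂ} (ha : a = a') (hb : b = b')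
    (h : Complex.normSq b < Complex.normSq a) :
    cayleyPoint a b h = cayleyPoint a' b' (ha ▸ hb ▸ h) := by
  subst ha hb; rfl

theorem normSq_I_mul (b : ℂ) : Complex.normSq (Complex.I * b) = Complex.normSq b := by
  simp [Complex.normSq_mul]

/-- The rotation `b ↦ i b` of the disc corresponds to `F T⁻¹`. -/
theorem cayleyPoint_I_mul (a b : ℂ) (h : Complex.normSq b < Complex.normSq a)
    (h' : Complex.normSq (Complex.I * b) < Complex.normSq a) :
    cayleyPoint a (Complex.I * b) h' = fricke • (ModularGroup.T⁻¹ • cayleyPoint a b h) := by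
  ext1
  have h1 := sub_ne_zero_of_normSq_lt h
  have h2 := sub_ne_zero_of_normSq_lt h'
  have e1 := ModularGroup.coe_T_zpow_smul_eq (z := cayleyPoint a b h) (n := -1)
  rw [zpow_neg_one] at e1
  rw [coe_fricke_smul, e1, coe_cayleyPoint, coe_cayleyPoint]
  have e2 : cayleyCoord a b + ((-1 : ℤ) : ℂ) =
      (Complex.I - 1) * (a - Complex.I * b) / (2 * (a - b)) := by
    rw [cayleyCoord, eq_div_iff (by simpa using h1), add_mul, div_mul_cancel₀ _ (by simpa using h1)]
    push_cast
    linear_combination b * Complex.I_sq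
  have h3 : Complex.I - 1 ≠ 0 := fun e => by simpa using congrArg Complex.im e
  rw [e2, cayleyCoord, div_eq_div_iff (by simpa using h2) (by
    refine mul_ne_zero two_ne_zero (div_ne_zero (mul_ne_zero h3 h2) (by simpa using h1)))]
  field_simp
  linear_combination (a + Complex.I * b - 2 * b) * Complex.I_sq

/-- The isometry of the hermitian form `|a|² - |b|²` with rows `(α, β)`, `(β̄, ᾱ)`, where
`α = x + i y` and `β = s + i t` are Gaussian integers, corresponds to an element of `Γ₀(2)`. -/
theorem cayleyPoint_su (x y s t : ℤ)
    (g : SL(2, ℤ)) (hg : g.1 = !![x + y + s + t, -(y + s); 2 * (y + t), x - y - s - t])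
    (a b : ℂ) (h : Complex.normSq b < Complex.normSq a)
    (h' : Complex.normSq ((s - t * Complex.I) * a + (x - y * Complex.I) * b) <
      Complex.normSq ((x + y * Complex.I) * a + (s + t * Complex.I) * b)) :
    cayleyPoint ((x + y * Complex.I) * a + (s + t * Complex.I) * b)
      ((s - t * Complex.I) * a + (x - y * Complex.I) * b) h' = g • cayleyPoint a b h := by
  ext1
  have h1 := sub_ne_zero_of_normSq_lt h
  have hD : (2 * (a - b) : ℂ) ≠ 0 := by simpa using h1
  have e1 : (cayleyPoint a b h : ℂ) * (2 * (a - b)) =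
      (1 + Complex.I) * a + (Complex.I - 1) * b := div_mul_cancel₀ _ hD
  rw [UpperHalfPlane.coe_specialLinearGroup_apply, hg]
  simp only [algebraMap_int_eq, eq_intCast, Complex.ofReal_intCast, Matrix.of_apply,
    Matrix.cons_val', Matrix.cons_val_zero, Matrix.cons_val_one, Matrix.cons_val_fin_one]
  push_cast
  rw [coe_cayleyPoint a b h] at e1 ⊢
  rw [coe_cayleyPoint, ← mul_div_mul_right _ _ hD]
  unfold cayleyCoord at e1 ⊢
  congr 1
  · linear_combination (-(x + y + s + t) : ℂ) * e1 + ((y - t) * (a - b)) * Complex.I_sq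
  · linear_combination (-(2 * (y + t)) : ℂ) * e1

/-! ### Isometries of `T` commuting with `ρ` as Gaussian unitary matrices -/

/-- The endomorphism of `T = ℤ[i]²`, where `ρ` is multiplication by `i`, given by the Gaussian
integer matrix with rows `(x₁ + i y₁, x₂ + i y₂)` and `(x₃ + i y₃, x₄ + i y₄)`. -/
def gaussBlock (x₁ y₁ x₂ y₂ x₃ y₃ x₄ y₄ : ℤ) : Matrix (Fin 4) (Fin 4) ℤ :=
  !![x₁, -y₁, x₂, -y₂; y₁, x₁, y₂, x₂; x₃, -y₃, x₄, -y₄; y₃, x₃, y₄, x₄]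

theorem eq_gaussBlock_of_commute {M : Matrix (Fin 4) (Fin 4) ℤ} (h : M * matJ = matJ * M) :
    M = gaussBlock (M 0 0) (M 1 0) (M 0 2) (M 1 2) (M 2 0) (M 3 0) (M 2 2) (M 3 2) := by
  have h' : ∀ i j, (M * matJ) i j = (matJ * M) i j := fun i j => by rw [h]
  have e := fun j => h' 0 j
  have e2 := fun j => h' 2 j
  simp only [matJ, Matrix.mul_apply, Fin.sum_univ_four, Fin.forall_fin_succ] at e e2
  simp at e e2
  ext i j
  fin_cases i <;> fin_cases j <;> simp [gaussBlock] <;> lia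

theorem gaussBlock_commute (x₁ y₁ x₂ y₂ x₃ y₃ x₄ y₄ : ℤ) :
    gaussBlock x₁ y₁ x₂ y₂ x₃ y₃ x₄ y₄ * matJ = matJ * gaussBlock x₁ y₁ x₂ y₂ x₃ y₃ x₄ y₄ := by
  ext i j
  fin_cases i <;> fin_cases j <;> simp [gaussBlock, matJ, Matrix.mul_apply, Fin.sum_univ_four]

/-- A matrix of Gaussian integers preserves the form of `T` if and only if it is unitary for the
hermitian form `|a|² - |b|²`. -/
theorem gaussBlock_orthogonal_iff (x₁ y₁ x₂ y₂ x₃ y₃ x₄ y₄ : ℤ) :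
    (gaussBlock x₁ y₁ x₂ y₂ x₃ y₃ x₄ y₄).transpose * gramT * gaussBlock x₁ y₁ x₂ y₂ x₃ y₃ x₄ y₄ =
      gramT ↔
    x₁ ^ 2 + y₁ ^ 2 - x₃ ^ 2 - y₃ ^ 2 = 1 ∧ x₂ ^ 2 + y₂ ^ 2 - x₄ ^ 2 - y₄ ^ 2 = -1 ∧
      x₁ * x₂ + y₁ * y₂ - x₃ * x₄ - y₃ * y₄ = 0 ∧ x₁ * y₂ - y₁ * x₂ - x₃ * y₄ + y₃ * x₄ = 0 := by
  constructor
  · intro h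
    have h' : ∀ i j, ((gaussBlock x₁ y₁ x₂ y₂ x₃ y₃ x₄ y₄).transpose * gramT *
      gaussBlock x₁ y₁ x₂ y₂ x₃ y₃ x₄ y₄) i j = gramT i j := fun i j => by rw [h]
    have e1 := h' 0 0
    have e2 := h' 2 2
    have e3 := h' 0 2
    have e4 := h' 0 3
    simp [gaussBlock, gramT, Matrix.mul_apply, Fin.sum_univ_four, Matrix.diagonal] at e1 e2 e3 e4
    refine ⟨?_, ?_, ?_, ?_⟩ <;> linarith
  · rintro ⟨e1, e2, e3, e4⟩
    ext i j
    fin_cases i <;> fin_cases j <;>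
      simp [gaussBlock, gramT, Matrix.mul_apply, Fin.sum_univ_four, Matrix.diagonal] <;> linarith

/-- A unitary matrix of Gaussian integers for `|a|² - |b|²` has rows `(α, β)`, `(u β̄, u ᾱ)` with
`|α|² - |β|² = 1` and `u` a unit. -/
theorem gauss_unitary_cases {x₁ y₁ x₂ y₂ x₃ y₃ x₄ y₄ : ℤ}
    (e₁ : x₁ ^ 2 + y₁ ^ 2 - x₃ ^ 2 - y₃ ^ 2 = 1) (e₂ : x₂ ^ 2 + y₂ ^ 2 - x₄ ^ 2 - y₄ ^ 2 = -1)
    (e₃ : x₁ * x₂ + y₁ * y₂ - x₃ * x₄ - y₃ * y₄ = 0)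
    (e₄ : x₁ * y₂ - y₁ * x₂ - x₃ * y₄ + y₃ * x₄ = 0) :
    x₁ ^ 2 + y₁ ^ 2 - x₂ ^ 2 - y₂ ^ 2 = 1 ∧
      ((x₃ = x₂ ∧ y₃ = -y₂ ∧ x₄ = x₁ ∧ y₄ = -y₁) ∨ (x₃ = -x₂ ∧ y₃ = y₂ ∧ x₄ = -x₁ ∧ y₄ = y₁) ∨
      (x₃ = y₂ ∧ y₃ = x₂ ∧ x₄ = y₁ ∧ y₄ = x₁) ∨
      (x₃ = -y₂ ∧ y₃ = -x₂ ∧ x₄ = -y₁ ∧ y₄ = -x₁)) := by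
  -- `|α|² |β|² = |c|² |d|²`, by the orthogonality of the columns
  have h1 : (x₁ ^ 2 + y₁ ^ 2) * (x₂ ^ 2 + y₂ ^ 2) = (x₃ ^ 2 + y₃ ^ 2) * (x₄ ^ 2 + y₄ ^ 2) := by
    linear_combination (x₁ * x₂ + y₁ * y₂ + x₃ * x₄ + y₃ * y₄) * e₃ +
      (x₁ * y₂ - y₁ * x₂ + x₃ * y₄ - y₃ * x₄) * e₄
  have h2 : x₄ ^ 2 + y₄ ^ 2 - x₃ ^ 2 - y₃ ^ 2 = 1 := by
    linear_combination h1 - (x₂ ^ 2 + y₂ ^ 2) * e₁ - (x₃ ^ 2 + y₃ ^ 2 + 1) * e₂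
  have h3 : x₁ ^ 2 + y₁ ^ 2 - x₂ ^ 2 - y₂ ^ 2 = 1 := by linear_combination e₁ - e₂ - h2
  refine ⟨h3, ?_⟩
  -- `d = u ᾱ` and `c = u β̄` hold for the determinant `u = m + i n`
  obtain ⟨m, hm⟩ : ∃ m, m = x₁ * x₄ - y₁ * y₄ - x₂ * x₃ + y₂ * y₃ := ⟨_, rfl⟩
  obtain ⟨n, hn⟩ : ∃ n, n = x₁ * y₄ + y₁ * x₄ - x₂ * y₃ - y₂ * x₃ := ⟨_, rfl⟩
  have d1 : x₄ = m * x₁ + n * y₁ := by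
    subst hm hn
    linear_combination (-x₄) * e₁ + x₃ * e₃ + (-y₃) * e₄
  have d2 : y₄ = n * x₁ - m * y₁ := by
    subst hm hn
    linear_combination (-y₄) * e₁ + y₃ * e₃ + x₃ * e₄
  have c1 : x₃ = m * x₂ + n * y₂ := by
    subst hm hn
    linear_combination x₃ * e₂ + (-x₄) * e₃ + (-y₄) * e₄
  have c2 : y₃ = n * x₂ - m * y₂ := by
    subst hm hn
    linear_combination y₃ * e₂ + (-y₄) * e₃ + x₄ * e₄
  have hmn : m ^ 2 + n ^ 2 = 1 := by
    rw [d1, d2, c1, c2] at h2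
    linear_combination h2 - (m ^ 2 + n ^ 2) * h3
  have hm1 : m ^ 2 ≤ 1 := by nlinarith
  have hn1 : n ^ 2 ≤ 1 := by nlinarith
  have hm2 : -1 ≤ m ∧ m ≤ 1 := abs_le.1 (sq_le_one_iff_abs_le_one m |>.1 hm1)
  have hn2 : -1 ≤ n ∧ n ≤ 1 := abs_le.1 (sq_le_one_iff_abs_le_one n |>.1 hn1)
  clear hm hn e₁ e₂ e₃ e₄ h1 h2 h3 hm1 hn1
  obtain ⟨hma, hmb⟩ := hm2
  obtain ⟨hna, hnb⟩ := hn2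
  interval_cases m <;> interval_cases n <;> simp at hmn <;> simp at d1 d2 c1 c2 <;> simp [*]

/-! ### The period domain -/

theorem Projectivization.isOpenQuotientMap_mk' {V : Type*} [AddCommGroup V] [Module ℂ V]
    [TopologicalSpace V] [ContinuousConstSMul ℂ V] :
    IsOpenQuotientMap (Projectivization.mk' ℂ : {v : V // v ≠ 0} → ℙ ℂ V) := by
  have hq : IsQuotientMap (Projectivization.mk' ℂ : {v : V // v ≠ 0} → ℙ ℂ V) :=
    ⟨⟨rfl⟩, Quotient.mk''_surjective⟩
  refine .of_isOpenMap_isQuotientMap (fun U hU => ?_) hq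
  rw [← hq.isOpen_preimage]
  -- the saturation of `U` is the union of its multiples
  let m : ℂˣ → {v : V // v ≠ 0} → {v : V // v ≠ 0} := fun c v =>
    ⟨(c : ℂ) • v.1, smul_ne_zero c.ne_zero v.2⟩
  have e : Projectivization.mk' ℂ ⁻¹' (Projectivization.mk' ℂ '' U) = ⋃ c, m c ⁻¹' U := by
    ext v
    simp only [mem_preimage, mem_image, mem_iUnion]
    constructor
    · rintro ⟨w, hw, h⟩
      obtain ⟨c, hc⟩ := (Projectivization.mk_eq_mk_iff ℂ _ _ w.2 v.2).1 h
      exact ⟨c, (Subtype.ext hc : m c v = w) ▸ hw⟩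
    · rintro ⟨c, hc⟩
      exact ⟨_, hc, (Projectivization.mk_eq_mk_iff ℂ _ _ (m c v).2 v.2).2 ⟨c, rfl⟩⟩
  rw [e]
  exact isOpen_iUnion fun c => hU.preimage
    ((continuous_subtype_val.const_smul (c : ℂ)).subtype_mk _)

/-- The eigenspace `ρ = i` consists of the vectors `(a, -i a, b, -i b)`, on which the hermitian form
`(z, z̄)` is `4 (|a|² - |b|²)`. -/
theorem mk_mem_periodDomain_iff {v : Fin 4 → ℂ} (hv : v ≠ 0) :
    Projectivization.mk ℂ v hv ∈ periodDomain gramT matJ ↔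
      v 1 = -Complex.I * v 0 ∧ v 3 = -Complex.I * v 2 ∧
        Complex.normSq (v 2) < Complex.normSq (v 0) := by
  have hform : ∀ w : Fin 4 → ℂ,
      (w ⬝ᵥ (gramT.map (Int.cast : ℤ → ℂ)).mulVec (star w)).re =
        2 * Complex.normSq (w 0) + 2 * Complex.normSq (w 1) - 2 * Complex.normSq (w 2) -
          2 * Complex.normSq (w 3) := by
    intro w
    simp [gramT, dotProduct, Matrix.mulVec, Fin.sum_univ_four, Matrix.diagonal,
      Complex.normSq_apply]
    ring
  have hJ : ∀ w : Fin 4 → ℂ, (matJ.map (Int.cast : ℤ → ℂ)).mulVec w = Complex.I • w ↔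
      w 1 = -Complex.I * w 0 ∧ w 3 = -Complex.I * w 2 := by
    intro w
    have : (matJ.map (Int.cast : ℤ → ℂ)).mulVec w = ![-w 1, w 0, -w 3, w 2] := by
      ext i
      fin_cases i <;> simp [matJ, Matrix.mulVec, dotProduct, Fin.sum_univ_four]
    rw [this, funext_iff]
    simp only [Fin.forall_fin_succ, Pi.smul_apply, smul_eq_mul]
    simp
    constructor
    · rintro ⟨h1, -, h3, -⟩
      exact ⟨by rw [← h1, neg_neg], by rw [← h3, neg_neg]⟩
    · rintro ⟨h1, h3⟩
      rw [h1, h3]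
      refine ⟨by simp, ?_, by simp, ?_⟩ <;> simp [← mul_assoc]
  constructor
  · intro h
    obtain ⟨h1, h2⟩ := h v (by
      rw [Projectivization.submodule_mk]; exact Submodule.mem_span_singleton_self v) hv
    obtain ⟨e1, e3⟩ := (hJ v).1 h1
    refine ⟨e1, e3, ?_⟩
    rw [hform, e1, e3] at h2
    simp [Complex.normSq_mul] at h2
    linarith
  · rintro ⟨e1, e3, hlt⟩ w hw hw0
    rw [Projectivization.submodule_mk, Submodule.mem_span_singleton] at hw
    obtain ⟨c, rfl⟩ := hw
    have hc : c ≠ 0 := fun h => hw0 (by simp [h])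
    refine ⟨(hJ _).2 ⟨?_, ?_⟩, ?_⟩
    · simp only [Pi.smul_apply, smul_eq_mul, e1]; ring
    · simp only [Pi.smul_apply, smul_eq_mul, e3]; ring
    · rw [hform]
      have := mul_pos (Complex.normSq_pos.2 hc) (sub_pos.2 hlt)
      simp only [Pi.smul_apply, smul_eq_mul, e1, e3, Complex.normSq_mul, Complex.normSq_neg,
        Complex.normSq_I, one_mul]
      linarith

/-- The coordinate of a point of projective space under the Cayley transform. It is defined on all
of projective space, but is meaningful only on the period domain. -/
noncomputable def periodCoord (p : ℙ ℂ (Fin 4 → ℂ)) : ℂ := cayleyCoord (p.rep 0) (p.rep 2)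

theorem periodCoord_mk {v : Fin 4 → ℂ} (hv : v ≠ 0) :
    periodCoord (Projectivization.mk ℂ v hv) = cayleyCoord (v 0) (v 2) := by
  obtain ⟨c, hc⟩ := Projectivization.exists_smul_eq_mk_rep ℂ v hv
  rw [periodCoord, ← hc]
  exact cayleyCoord_smul c.ne_zero _ _

theorem periodCoord_im_pos {p : ℙ ℂ (Fin 4 → ℂ)} (hp : p ∈ periodDomain gramT matJ) :
    0 < (periodCoord p).im := by
  induction p using Projectivization.ind with
  | h v hv =>
    rw [periodCoord_mk]
    exact (cayleyPoint _ _ ((mk_mem_periodDomain_iff hv).1 hp).2.2).im_pos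

/-- The vector spanning the line in `T ⊗ ℂ` with period `z` in the upper half plane. -/
noncomputable def periodVector (z : ℂ) : Fin 4 → ℂ :=
  ![z - (1 - Complex.I) / 2, -Complex.I * (z - (1 - Complex.I) / 2),
    z - (1 + Complex.I) / 2, -Complex.I * (z - (1 + Complex.I) / 2)]

theorem differentiable_periodVector : Differentiable ℂ periodVector := by
  rw [differentiable_pi]
  intro i
  fin_cases i <;> simp [periodVector]

theorem periodVector_normSq_lt (τ : ℍ) :
    Complex.normSq (periodVector τ 2) < Complex.normSq (periodVector τ 0) := by
  have := τ.im_pos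
  simp [periodVector, Complex.normSq_apply]
  nlinarith

theorem periodVector_ne_zero (τ : ℍ) : periodVector τ ≠ 0 := fun h => by
  have := periodVector_normSq_lt τ
  simp [h] at this

theorem mk_periodVector_mem (τ : ℍ) :
    Projectivization.mk ℂ (periodVector τ) (periodVector_ne_zero τ) ∈ periodDomain gramT matJ :=
  (mk_mem_periodDomain_iff _).2 ⟨rfl, rfl, periodVector_normSq_lt τ⟩

theorem cayleyCoord_periodVector (z : ℂ) :
    cayleyCoord (periodVector z 0) (periodVector z 2) = z := by
  have : (2 * (periodVector z 0 - periodVector z 2) : ℂ) ≠ 0 := by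
    have : (2 * (periodVector z 0 - periodVector z 2) : ℂ) = 2 * Complex.I := by
      simp [periodVector]; ring
    rw [this]
    simp
  rw [cayleyCoord, div_eq_iff this]
  simp [periodVector]
  ring

theorem periodVector_cayleyCoord {v : Fin 4 → ℂ} (h1 : v 1 = -Complex.I * v 0)
    (h3 : v 3 = -Complex.I * v 2) (h : Complex.normSq (v 2) < Complex.normSq (v 0)) :
    (Complex.I / (v 0 - v 2)) • v = periodVector (cayleyCoord (v 0) (v 2)) := by
  have h0 := sub_ne_zero_of_normSq_lt h
  ext i
  fin_cases i <;> simp [periodVector, cayleyCoord, h1, h3] <;> field_simp <;> ring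

/-- The period domain `D` is biholomorphic to the upper half plane. -/
noncomputable def periodHomeomorph : periodDomain gramT matJ ≃ₜ ℍ where
  toFun p := ⟨periodCoord p.1, periodCoord_im_pos p.2⟩
  invFun τ := ⟨_, mk_periodVector_mem τ⟩
  left_inv := by
    rintro ⟨p, hp⟩
    induction p using Projectivization.ind with
    | h v hv =>
      obtain ⟨h1, h3, h⟩ := (mk_mem_periodDomain_iff hv).1 hp
      refine Subtype.ext ((Projectivization.mk_eq_mk_iff' ℂ _ _ _ _).2
        ⟨Complex.I / (v 0 - v 2), ?_⟩)
      exact (periodVector_cayleyCoord h1 h3 h).trans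
        (congrArg periodVector (periodCoord_mk hv).symm)
  right_inv τ := by
    ext1
    exact (periodCoord_mk _).trans (cayleyCoord_periodVector τ)
  continuous_toFun := by
    rw [UpperHalfPlane.isEmbedding_coe.continuous_iff, continuous_iff_continuousAt]
    rintro ⟨p, hp⟩
    induction p using Projectivization.ind with
    | h v hv =>
      have h := sub_ne_zero_of_normSq_lt ((mk_mem_periodDomain_iff hv).1 hp).2.2
      refine ContinuousAt.comp (f := Subtype.val) (g := periodCoord) ?_ continuousAt_subtype_val
      refine (Projectivization.isOpenQuotientMap_mk'.continuousAt_comp_iff (x := ⟨v, hv⟩)).1 ?_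
      have : periodCoord ∘ Projectivization.mk' ℂ =
          fun w : {w : Fin 4 → ℂ // w ≠ 0} => cayleyCoord (w.1 0) (w.1 2) :=
        funext fun w => periodCoord_mk w.2
      rw [this]
      have hc : ∀ i, Continuous fun w : {w : Fin 4 → ℂ // w ≠ 0} => w.1 i := fun i =>
        (continuous_apply i).comp continuous_subtype_val
      exact (((hc 0).const_mul _).add ((hc 2).const_mul _)).continuousAt.div
        (((hc 0).sub (hc 2)).const_mul _).continuousAt (mul_ne_zero two_ne_zero h)
  continuous_invFun := by
    refine Continuous.subtype_mk ?_ _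
    exact Projectivization.isOpenQuotientMap_mk'.continuous.comp
      (f := fun τ : ℍ => ⟨periodVector τ, periodVector_ne_zero τ⟩)
      ((differentiable_periodVector.continuous.comp UpperHalfPlane.continuous_coe).subtype_mk _)

theorem periodHomeomorph_mk {v : Fin 4 → ℂ} (hv : v ≠ 0)
    (hp : Projectivization.mk ℂ v hv ∈ periodDomain gramT matJ) :
    periodHomeomorph ⟨_, hp⟩ =
      cayleyPoint (v 0) (v 2) ((mk_mem_periodDomain_iff hv).1 hp).2.2 := by
  ext1
  exact periodCoord_mk hv

/-- The homeomorphism between `D` and the upper half plane identifies the holomorphic functions. -/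
theorem mem_holo_iff_comp_periodHomeomorph (U : Opens ℍ) (f : U → ℂ) :
    f ∈ (AnalyticStructure.ofManifold ℍ).holo U ↔
      (fun x : Opens.comap (periodHomeomorph : C(periodDomain gramT matJ, ℍ)) U =>
        f ⟨periodHomeomorph x.1, x.2⟩) ∈
        (AnalyticStructure.ofProjective (periodDomain gramT matJ)).holo
          (Opens.comap (periodHomeomorph : C(periodDomain gramT matJ, ℍ)) U) := by
  have e1 := AnalyticStructure.mem_ofManifold_iff (U := U) (f := f)
    (F := Function.extend Subtype.val f 0) fun x => Subtype.val_injective.extend_apply f 0 x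
  refine e1.trans ⟨fun hf v hv hX hU => ?_, fun hf τ hτ => ?_⟩
  · -- in homogeneous coordinates the Cayley transform is a rational function
    have h0 := sub_ne_zero_of_normSq_lt ((mk_mem_periodDomain_iff hv).1 hX).2.2
    let W₀ : Set (Fin 4 → ℂ) := {w | w 0 - w 2 ≠ 0}
    have hW₀ : IsOpen W₀ := isOpen_ne_fun (by fun_prop) (by fun_prop)
    have hd : DifferentiableOn ℂ (fun w : Fin 4 → ℂ => cayleyCoord (w 0) (w 2)) W₀ := by
      intro w hw
      have hw' : 2 * (w 0 - w 2) ≠ 0 := mul_ne_zero two_ne_zero hw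
      unfold cayleyCoord
      refine DifferentiableAt.differentiableWithinAt ?_
      fun_prop (disch := exact hw')
    let V : Set ℂ := (↑) '' (U : Set ℍ)
    have hV : IsOpen V := UpperHalfPlane.isOpenEmbedding_coe.isOpenMap _ U.isOpen
    refine ⟨W₀ ∩ (fun w => cayleyCoord (w 0) (w 2)) ⁻¹' V,
      fun w => Function.extend Subtype.val f 0 (UpperHalfPlane.ofComplex (cayleyCoord (w 0) (w 2))),
      hd.continuousOn.isOpen_inter_preimage hW₀ hV, ⟨h0, ?_⟩, ?_, ?_⟩
    · refine ⟨_, hU, ?_⟩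
      exact periodCoord_mk hv
    · rintro w ⟨hw, τ, hτ, hwτ⟩
      have h1 := UpperHalfPlane.mdifferentiableAt_iff.1 (hf τ hτ)
      rw [hwτ] at h1
      have h2 := (hd w hw).differentiableAt (hW₀.mem_nhds hw)
      exact (h1.comp w h2).differentiableWithinAt
    · rintro w - hw hwX hwU
      have e : UpperHalfPlane.ofComplex (cayleyCoord (w 0) (w 2)) =
          periodHomeomorph ⟨_, hwX⟩ := by
        rw [periodHomeomorph_mk, ← coe_cayleyPoint (w 0) (w 2)
          ((mk_mem_periodDomain_iff hw).1 hwX).2.2, UpperHalfPlane.ofComplex_apply]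
      change Function.extend Subtype.val f 0 (UpperHalfPlane.ofComplex _) = _
      rw [e]
      exact Subtype.val_injective.extend_apply f 0 ⟨periodHomeomorph ⟨_, hwX⟩, hwU⟩
  · -- conversely, `periodVector` is a holomorphic choice of homogeneous coordinates
    have hinv : ∀ σ : ℍ, periodHomeomorph ⟨_, mk_periodVector_mem σ⟩ = σ :=
      periodHomeomorph.apply_symm_apply
    have hmem : ∀ σ ∈ U, (⟨_, mk_periodVector_mem σ⟩ : periodDomain gramT matJ) ∈
        Opens.comap (periodHomeomorph : C(periodDomain gramT matJ, ℍ)) U := fun σ hσ => by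
      change periodHomeomorph ⟨_, mk_periodVector_mem σ⟩ ∈ U
      rwa [hinv]
    obtain ⟨W, F, hW, hτW, hF, e⟩ := hf _ (periodVector_ne_zero τ) (mk_periodVector_mem τ)
      (hmem τ hτ)
    have h1 : DifferentiableAt ℂ (F ∘ periodVector) τ :=
      ((hF _ hτW).differentiableAt (hW.mem_nhds hτW)).comp _ (differentiable_periodVector _)
    have h2 : MDifferentiableAt 𝓘(ℂ, ℂ) 𝓘(ℂ, ℂ) (fun σ : ℍ => F (periodVector σ)) τ :=
      h1.mdifferentiableAt.comp τ (UpperHalfPlane.mdifferentiable_coe τ)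
    refine h2.congr_of_eventuallyEq ?_
    have hc : Continuous fun σ : ℍ => periodVector σ :=
      differentiable_periodVector.continuous.comp UpperHalfPlane.continuous_coe
    filter_upwards [U.isOpen.mem_nhds hτ, (hW.preimage hc).mem_nhds hτW] with σ hσU hσW
    rw [e _ hσW (periodVector_ne_zero σ) (mk_periodVector_mem σ) (hmem σ hσU)]
    refine (Subtype.val_injective.extend_apply f 0 ⟨σ, hσU⟩).trans (congrArg f (Subtype.ext ?_))
    exact (hinv σ).symm

/-! ### Comparison of the two groups -/

theorem gaussBlock_mulVec (x₁ y₁ x₂ y₂ x₃ y₃ x₄ y₄ : ℤ) {v : Fin 4 → ℂ}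
    (h1 : v 1 = -Complex.I * v 0) (h3 : v 3 = -Complex.I * v 2) :
    ((gaussBlock x₁ y₁ x₂ y₂ x₃ y₃ x₄ y₄).map (Int.cast : ℤ → ℂ)).mulVec v 0 =
      (x₁ + y₁ * Complex.I) * v 0 + (x₂ + y₂ * Complex.I) * v 2 ∧
    ((gaussBlock x₁ y₁ x₂ y₂ x₃ y₃ x₄ y₄).map (Int.cast : ℤ → ℂ)).mulVec v 2 =
      (x₃ + y₃ * Complex.I) * v 0 + (x₄ + y₄ * Complex.I) * v 2 := by
  constructor <;> simp [gaussBlock, Matrix.mulVec, dotProduct, Fin.sum_univ_four, h1, h3] <;> ring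

/-- In homogeneous disc coordinates `Γ` acts by two-by-two matrices of Gaussian integers. -/
theorem periodHomeomorph_smul {γ : isometryCentralizer gramT matJ}
    {x₁ y₁ x₂ y₂ x₃ y₃ x₄ y₄ : ℤ} (hγ : γ.1.val = gaussBlock x₁ y₁ x₂ y₂ x₃ y₃ x₄ y₄)
    {v : Fin 4 → ℂ} (hv : v ≠ 0) (hp : Projectivization.mk ℂ v hv ∈ periodDomain gramT matJ) :
    ∃ h, periodHomeomorph (γ • (⟨_, hp⟩ : periodDomain gramT matJ)) =
      cayleyPoint ((x₁ + y₁ * Complex.I) * v 0 + (x₂ + y₂ * Complex.I) * v 2)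
        ((x₃ + y₃ * Complex.I) * v 0 + (x₄ + y₄ * Complex.I) * v 2) h := by
  obtain ⟨h1, h3, -⟩ := (mk_mem_periodDomain_iff hv).1 hp
  obtain ⟨e0, e2⟩ := gaussBlock_mulVec x₁ y₁ x₂ y₂ x₃ y₃ x₄ y₄ h1 h3
  rw [← hγ] at e0 e2
  rw [← e0, ← e2]
  have hw : latticeAut γ.1 • v ≠ 0 := (smul_ne_zero_iff_ne _).2 hv
  have hm : latticeAut γ.1 • Projectivization.mk ℂ v hv =
      Projectivization.mk ℂ (latticeAut γ.1 • v) hw := Projectivization.smul_mk _ _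
  have hp' := hm ▸ latticeAut_smul_mem_periodDomain γ.2 hp
  refine ⟨((mk_mem_periodDomain_iff hw).1 hp').2.2, ?_⟩
  have : γ • (⟨_, hp⟩ : periodDomain gramT matJ) = ⟨_, hp'⟩ := Subtype.ext hm
  rw [this, periodHomeomorph_mk]
  rfl

theorem exists_isometryCentralizer_eq_gaussBlock {x₁ y₁ x₂ y₂ x₃ y₃ x₄ y₄ : ℤ}
    (h : x₁ ^ 2 + y₁ ^ 2 - x₃ ^ 2 - y₃ ^ 2 = 1 ∧ x₂ ^ 2 + y₂ ^ 2 - x₄ ^ 2 - y₄ ^ 2 = -1 ∧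
      x₁ * x₂ + y₁ * y₂ - x₃ * x₄ - y₃ * y₄ = 0 ∧ x₁ * y₂ - y₁ * x₂ - x₃ * y₄ + y₃ * x₄ = 0) :
    ∃ γ : isometryCentralizer gramT matJ, γ.1.val = gaussBlock x₁ y₁ x₂ y₂ x₃ y₃ x₄ y₄ := by
  have hM := (gaussBlock_orthogonal_iff x₁ y₁ x₂ y₂ x₃ y₃ x₄ y₄).2 h
  have hdet := congrArg Matrix.det hM
  rw [Matrix.det_mul, Matrix.det_mul, Matrix.det_transpose] at hdet
  have hT : gramT.det = 16 := by
    simp [gramT, Fin.prod_univ_four]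
  rw [hT] at hdet
  have hu : IsUnit (gaussBlock x₁ y₁ x₂ y₂ x₃ y₃ x₄ y₄).det :=
    IsUnit.of_mul_eq_one (gaussBlock x₁ y₁ x₂ y₂ x₃ y₃ x₄ y₄).det (by linarith)
  exact ⟨⟨Matrix.nonsingInvUnit _ hu, hM, gaussBlock_commute _ _ _ _ _ _ _ _⟩, rfl⟩

theorem orbitRel_cayleyPoint_I_mul (a b : ℂ) (h : Complex.normSq b < Complex.normSq a)
    (h' : Complex.normSq (Complex.I * b) < Complex.normSq a) :
    MulAction.orbitRel frickeGroup ℍ (cayleyPoint a (Complex.I * b) h') (cayleyPoint a b h) :=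
  frickeGroup_orbitRel_iff.2 ⟨ModularGroup.T⁻¹, by simp,
    Or.inr (cayleyPoint_I_mul a b h h')⟩

/-- The formulas of `cayleyPoint_su` can be solved for `x`, `y`, `s`, `t` in integers, since the
diagonal entries of an element of `Γ₀(2)` are odd. -/
theorem exists_eq_of_mem_Gamma0 {g : SL(2, ℤ)} (hg : g ∈ CongruenceSubgroup.Gamma0 2) :
    ∃ x y s t : ℤ, g.1 = !![x + y + s + t, -(y + s); 2 * (y + t), x - y - s - t] ∧
      x ^ 2 + y ^ 2 - s ^ 2 - t ^ 2 = 1 := by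
  obtain ⟨k, hk⟩ := (ZMod.intCast_zmod_eq_zero_iff_dvd _ 2).1 (CongruenceSubgroup.Gamma0_mem.1 hg)
  have hk : g.1 1 0 = 2 * k := hk
  have hdet : g.1 0 0 * g.1 1 1 - g.1 0 1 * g.1 1 0 = 1 := by
    rw [← Matrix.det_fin_two]; exact g.2
  rw [hk] at hdet
  -- the diagonal entries are odd
  have hodd : Odd (g.1 0 0 * g.1 1 1) := ⟨g.1 0 1 * k, by linarith⟩
  obtain ⟨⟨m, hm⟩, ⟨n, hn⟩⟩ := Int.odd_mul.1 hodd
  refine ⟨m + n + 1, k - g.1 0 1 - (m - n), -k + (m - n), g.1 0 1 + (m - n), ?_, ?_⟩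
  · ext i j
    fin_cases i <;> fin_cases j <;> simp [hm, hn, hk] <;> ring
  · rw [hm, hn] at hdet
    linear_combination hdet

theorem orbitRel_periodHomeomorph_of_orbitRel {p p' : periodDomain gramT matJ}
    (h : MulAction.orbitRel (isometryCentralizer gramT matJ) (periodDomain gramT matJ) p p') :
    MulAction.orbitRel frickeGroup ℍ (periodHomeomorph p) (periodHomeomorph p') := by
  obtain ⟨γ, rfl⟩ := h
  obtain ⟨p', hp⟩ := p'
  induction p' using Projectivization.ind with
  | h v hv =>
  have hγ := eq_gaussBlock_of_commute γ.2.2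
  have horth : γ.1.val.transpose * gramT * γ.1.val = gramT := γ.2.1
  obtain ⟨hlt, e⟩ := periodHomeomorph_smul hγ hv hp
  rw [hγ, gaussBlock_orthogonal_iff] at horth
  obtain ⟨o1, o2, o3, o4⟩ := horth
  obtain ⟨hdet, hcases⟩ := gauss_unitary_cases o1 o2 o3 o4
  change MulAction.orbitRel frickeGroup ℍ (periodHomeomorph (γ • _)) _
  rw [e, periodHomeomorph_mk]
  generalize γ.1.val 0 0 = x at *
  generalize γ.1.val 1 0 = y at *
  generalize γ.1.val 0 2 = s at *
  generalize γ.1.val 1 2 = t at *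
  generalize γ.1.val 2 0 = x₃ at *
  generalize γ.1.val 3 0 = y₃ at *
  generalize γ.1.val 2 2 = x₄ at *
  generalize γ.1.val 3 2 = y₄ at *
  clear e hγ o1 o2 o3 o4
  obtain ⟨a', ha'⟩ : ∃ a', a' = (x + y * Complex.I) * v 0 + (s + t * Complex.I) * v 2 := ⟨_, rfl⟩
  obtain ⟨b', hb'⟩ : ∃ b', b' = (s - t * Complex.I) * v 0 + (x - y * Complex.I) * v 2 := ⟨_, rfl⟩
  let g : SL(2, ℤ) := ⟨!![x + y + s + t, -(y + s); 2 * (y + t), x - y - s - t], by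
    rw [Matrix.det_fin_two_of]; linear_combination hdet⟩
  have hg : g ∈ CongruenceSubgroup.Gamma0 2 := by
    rw [CongruenceSubgroup.Gamma0_mem]
    exact (ZMod.intCast_zmod_eq_zero_iff_dvd _ 2).2 ⟨y + t, rfl⟩
  -- the case of determinant one
  have h0 : ∀ h, MulAction.orbitRel frickeGroup ℍ (cayleyPoint a' b' h)
      (cayleyPoint (v 0) (v 2) ((mk_mem_periodDomain_iff hv).1 hp).2.2) := by
    subst ha' hb'
    intro h
    exact frickeGroup_orbitRel_iff.2 ⟨g, hg, Or.inl (cayleyPoint_su x y s t g rfl _ _ _ h)⟩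
  -- multiplication of the second coordinate by `i`
  have hI : ∀ b : ℂ, (∀ h, MulAction.orbitRel frickeGroup ℍ (cayleyPoint a' b h)
      (cayleyPoint (v 0) (v 2) ((mk_mem_periodDomain_iff hv).1 hp).2.2)) →
      ∀ h, MulAction.orbitRel frickeGroup ℍ (cayleyPoint a' (Complex.I * b) h)
      (cayleyPoint (v 0) (v 2) ((mk_mem_periodDomain_iff hv).1 hp).2.2) := fun b hb h =>
    Setoid.trans' _ (orbitRel_cayleyPoint_I_mul a' b (normSq_I_mul b ▸ h) h) (hb _)
  have hfin : ∀ b : ℂ, (∀ h, MulAction.orbitRel frickeGroup ℍ (cayleyPoint a' b h)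
      (cayleyPoint (v 0) (v 2) ((mk_mem_periodDomain_iff hv).1 hp).2.2)) →
      (x₃ + y₃ * Complex.I) * v 0 + (x₄ + y₄ * Complex.I) * v 2 = b →
      MulAction.orbitRel frickeGroup ℍ (cayleyPoint _ _ hlt)
      (cayleyPoint (v 0) (v 2) ((mk_mem_periodDomain_iff hv).1 hp).2.2) := by
    rintro b hb rfl
    subst ha'
    exact hb hlt
  rcases hcases with ⟨r1, r2, r3, r4⟩ | ⟨r1, r2, r3, r4⟩ | ⟨r1, r2, r3, r4⟩ | ⟨r1, r2, r3, r4⟩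
  · refine hfin _ h0 ?_
    rw [hb', r1, r2, r3, r4]
    push_cast
    ring
  · refine hfin _ (hI _ (hI _ h0)) ?_
    rw [hb', r1, r2, r3, r4, ← mul_assoc, Complex.I_mul_I]
    push_cast
    ring
  · refine hfin _ (hI _ h0) ?_
    rw [hb', r1, r2, r3, r4]
    linear_combination (t * v 0 + y * v 2) * Complex.I_sq
  · refine hfin _ (hI _ (hI _ (hI _ h0))) ?_
    rw [hb', r1, r2, r3, r4, ← mul_assoc Complex.I Complex.I, Complex.I_mul_I]
    push_cast
    linear_combination (-(t * v 0 + y * v 2)) * Complex.I_sq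

theorem orbitRel_of_orbitRel_periodHomeomorph {p p' : periodDomain gramT matJ}
    (h : MulAction.orbitRel frickeGroup ℍ (periodHomeomorph p) (periodHomeomorph p')) :
    MulAction.orbitRel (isometryCentralizer gramT matJ) (periodDomain gramT matJ) p p' := by
  obtain ⟨p', hp⟩ := p'
  induction p' using Projectivization.ind with
  | h v hv =>
  rw [periodHomeomorph_mk] at h
  suffices ∃ γ : isometryCentralizer gramT matJ,
      periodHomeomorph (γ • (⟨_, hp⟩ : periodDomain gramT matJ)) = periodHomeomorph p by
    obtain ⟨γ, hγ⟩ := this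
    exact ⟨γ, periodHomeomorph.injective hγ⟩
  obtain ⟨g, hg, h | h⟩ := frickeGroup_orbitRel_iff.1 h
  · obtain ⟨x, y, s, t, hgm, hdet⟩ := exists_eq_of_mem_Gamma0 hg
    obtain ⟨γ, hγ⟩ := exists_isometryCentralizer_eq_gaussBlock
      (x₁ := x) (y₁ := y) (x₂ := s) (y₂ := t) (x₃ := s) (y₃ := -t) (x₄ := x) (y₄ := -y)
      ⟨by linear_combination hdet, by linear_combination -hdet, by ring, by ring⟩
    obtain ⟨hlt, e⟩ := periodHomeomorph_smul hγ hv hp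
    refine ⟨γ, e.trans (Eq.trans ?_ h.symm)⟩
    have e2 : ((s : ℂ) + ((-t : ℤ) : ℂ) * Complex.I) * v 0 +
        (x + ((-y : ℤ) : ℂ) * Complex.I) * v 2 =
        (s - t * Complex.I) * v 0 + (x - y * Complex.I) * v 2 := by push_cast; ring
    rw [cayleyPoint_congr rfl e2]
    exact cayleyPoint_su x y s t g hgm _ _ _ _
  · -- write `F g = (F T⁻¹) (T g)`
    have hTg : ModularGroup.T * g ∈ CongruenceSubgroup.Gamma0 2 :=
      mul_mem (by simp) hg
    obtain ⟨x, y, s, t, hgm, hdet⟩ := exists_eq_of_mem_Gamma0 hTg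
    obtain ⟨γ, hγ⟩ := exists_isometryCentralizer_eq_gaussBlock
      (x₁ := x) (y₁ := y) (x₂ := s) (y₂ := t) (x₃ := t) (y₃ := s) (x₄ := y) (y₄ := x)
      ⟨by linear_combination hdet, by linear_combination -hdet, by ring, by ring⟩
    obtain ⟨hlt, e⟩ := periodHomeomorph_smul hγ hv hp
    refine ⟨γ, e.trans (Eq.trans ?_ h.symm)⟩
    have e2 : ((t : ℂ) + s * Complex.I) * v 0 + (y + x * Complex.I) * v 2 =
        Complex.I * ((s - t * Complex.I) * v 0 + (x - y * Complex.I) * v 2) := by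
      linear_combination (t * v 0 + y * v 2) * Complex.I_sq
    rw [cayleyPoint_congr rfl e2,
      cayleyPoint_I_mul _ _ (by rw [e2, normSq_I_mul] at hlt; exact hlt),
      cayleyPoint_su x y s t _ hgm _ _ ((mk_mem_periodDomain_iff hv).1 hp).2.2, mul_smul,
      inv_smul_smul]

/-- The Cayley transform carries `Γ` to the Fricke group, up to elements acting trivially, and so
descends to the quotients. -/
theorem moduliAnalytic_isomorphic_frickeAnalytic : moduliAnalytic.Isomorphic frickeAnalytic :=
  AnalyticStructure.isomorphic_orbitSpace periodHomeomorph mem_holo_iff_comp_periodHomeomorph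
    fun _ _ => ⟨orbitRel_periodHomeomorph_of_orbitRel, orbitRel_of_orbitRel_periodHomeomorph⟩

theorem mainTheorem5 :
    moduliAnalytic.Isomorphic frickeAnalytic ∧ frickeAnalytic.Isomorphic affineLine :=
  ⟨moduliAnalytic_isomorphic_frickeAnalytic, frickeAnalytic_isomorphic_affineLine⟩
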